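/- Let $T_1,T_2,\dots$ be i.i.d. $\mathrm{Exp}(1)$ random variables and, for $1\le m\le n$, let $M_n^{(m)}$ be the $m$-th largest of $T_1,\dots,T_n$. Let $H_n=\sum_{j=1}^n 1/j$ (with $H_0=0$) and let $\gamma$ be Euler's constant. (i) For $1\le m\le n$ and every complex $s$ with $\operatorname{Re}s<m$, $e^{sM_n^{(m)}}$ is integrable and $$\mathbb E\, e^{sM_n^{(m)}}=\frac{\Gamma(n+1)\,\Gamma(m-s)}{\Gamma(m)\,\Gamma(n+1-s)};$$ moreover $M_n^{(m)}$ is integrable with $\mathbb E M_n^{(m)}=H_n-H_{m-1}$. (ii) As $n\to\infty$, $M_n^{(m)}-\log n$ converges in distribution, jointly for all $m\ge1$ (that is, in $\mathbb R^{\mathbb N}$ with the product topology, where $M_n^{(m)}$ is given the value $0$ for $m>n$), to a random sequence $(W^{(m)})_{m\ge1}$. In particular $M_n^{(m)}-\log n\to W^{(m)}$ in distribution for each $m$. For every such limit sequence $(W^{(m)})_{m\ge1}$ the following hold. (iii) For each $m\ge1$, $W^{(m)}\overset{d}{=}-\log\Gamma_m$, where $\Gamma_m$ has the Gamma distribution with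 shape $m$ and rate $1$; and for every complex $s$ with $\operatorname{Re}s<m$, $e^{sW^{(m)}}$ is integrable with $\mathbb E\,e^{sW^{(m)}}=\Gamma(m-s)/\Gamma(m)$. (iv) For each $m\ge1$, $W^{(m)}$ is integrable and $$\mathbb E W^{(m)}=\lim_{n\to\infty}\mathbb E\bigl(M_n^{(m)}-\log n\bigr)=\lim_{n\to\infty}\bigl(H_n-H_{m-1}-\log n\bigr)=\gamma-H_{m-1}.$$ (v) For each $m\ge1$ the series $\sum_{j=m}^\infty \frac1j(T_j-1)$ converges in $L^2$ and almost surely, and, jointly for all $m\ge1$, $$\sum_{j=m}^\infty\frac1j(T_j-1)\overset{d}{=}W^{(m)}-\mathbb E W^{(m)}= W^{(m)}-\gamma+H_{m-1}.$$ (vi) $W^{(1)}$ has the Gumbel distribution $\mathbb P(W^{(1)}\le x)=e^{-e^{-x}}$, $x\in\mathbb R$, and $W^{(1)},W^{(2)},\dots$ is a homogeneous Markov chain: for every $m\ge1$, the conditional distribution of $W^{(m+1)}$ given $W^{(1)},\dots,W^{(m)}$ is that of $(W\mid W\le W^{(m)})$, where $W$ is a Gumbel variable independent of $W^{(m)}$.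 Explicitly, for all $m\ge1$ and $x\le y$, $$\mathbb P\bigl(W^{(m+1)}\le x\mid W^{(m)}=y\bigr)=\exp\bigl(e^{-y}-e^{-x}\bigr).$$ (vii) As random sequences, $\bigl(e^{-W^{(1)}},e^{-W^{(2)}},\dots\bigr)\overset{d}{=}\bigl(T_1,\,T_1+T_2,\,T_1+T_2+T_3,\dots\bigr)$. -/

import Mathlib

open MeasureTheory ProbabilityTheory Filter Topology

/-- The `(k+1)`-st largest of the `n` real numbers `x 0, …, x (n-1)` (so `k = 0` is the maximum):
`Tuple.sort` lists the numbers in increasing order and `Fin.rev k` is position `n - 1 - k`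
of that list. If `k ≥ n` there is no such number, and the value is `0`. -/
noncomputable def kthLargest (n k : ℕ) (x : ℕ → ℝ) : ℝ :=
  if h : k < n then
    x ((Tuple.sort (fun i : Fin n => x i) (Fin.rev ⟨k, h⟩) : Fin n) : ℕ)
  else 0

/-- `X 0, X 1, …` is a time-homogeneous Markov chain with transition kernel `κ`: for every `k`,
the conditional distribution of `X (k+1)` given the whole history `(X 0, …, X k)`
is `κ (X k)`. -/
def IsHomogeneousMarkovChain {Ω S : Type*} [MeasurableSpace Ω] [MeasurableSpace S]
    (X : ℕ → Ω → S) (κ : Kernel S S) (P : Measure Ω) : Prop :=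
  IsMarkovKernel κ ∧ ∀ k : ℕ,
    HasCondDistrib (X (k + 1)) (fun ω => fun i : Fin (k + 1) => X i ω)
      (κ.comap (fun h : Fin (k + 1) → S => h (Fin.last k)) (measurable_pi_apply _)) P

/-!
By Rényi's representation, the decreasing order statistics of `n` independent `Exp(1)` variables
`x 0, …, x (n-1)` have, jointly, the law of the weighted tail sums `∑ j ∈ [k, n), x j / (j + 1)`.
If `S j = x 0 + ⋯ + x (j-1)`, the beta-gamma algebra shows that the increments
`(j + 1) (log S (j + 2) - log S (j + 1))` are again independent `Exp(1)` variables, so the tail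
sums may be evaluated on them; they telescope to `log S (n + 1) - log S (k + 1)`. By the strong law
of large numbers this minus `log n` tends almost surely to `-log S (k + 1)`, which identifies the
limit sequence. All moments, the centred series and the Markov property are read off from this
coupling: the transform of the tail sum is the quotient of those of `-log S (k + 1)` and of
`-log S (n + 1)`, as `-log S (k + 1)` is the sum of the tail sum and the independent variable
`-log S (n + 1)`.
-/

open scoped ENNReal

section GammaLaw

variable {a r : ℝ}

lemma measurable_gammaPDF (a r : ℝ) : Measurable (gammaPDF a r) :=
  (measurable_gammaPDFReal a r).ennreal_ofReal

lemma measurable_exponentialPDF (r : ℝ) : Measurable (exponentialPDF r) :=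
  measurable_gammaPDF 1 r

lemma lintegral_gammaMeasure {F : ℝ → ℝ≥0∞} (hF : Measurable F) :
    ∫⁻ x, F x ∂gammaMeasure a r = ∫⁻ x, gammaPDF a r x * F x := by
  rw [gammaMeasure, lintegral_withDensity_eq_lintegral_mul _ (measurable_gammaPDF a r) hF]
  rfl

lemma lintegral_expMeasure {F : ℝ → ℝ≥0∞} (hF : Measurable F) :
    ∫⁻ x, F x ∂expMeasure r = ∫⁻ x in Set.Ioi 0, .ofReal (r * Real.exp (-(r * x))) * F x := by
  rw [expMeasure, lintegral_gammaMeasure hF, ← lintegral_indicator measurableSet_Ioi]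
  refine lintegral_congr_ae ((Measure.ae_ne volume 0).mono fun x hx => ?_)
  rcases hx.lt_or_gt with hx | hx
  · simp [gammaPDF_of_neg hx, hx.le]
  · simp [gammaPDF_of_nonneg hx.le, hx]

/-- The last factor is the conditional density of `X` given `X + T = s`, for independent `X` and `T`
of laws `Gamma(a, r)` and `Exp(r)`. -/
lemma gammaPDF_mul_exponentialPDF_sub (ha : 0 < a) (hr : 0 < r) {x s : ℝ} (hx : x ∈ Set.Ioo 0 s) :
    gammaPDF a r x * exponentialPDF r (s - x) =
      gammaPDF (a + 1) r s * .ofReal (a / s ^ a * x ^ (a - 1)) := by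
  have hs : 0 < s := hx.1.trans hx.2
  have := Real.Gamma_pos_of_pos ha
  rw [gammaPDF_of_nonneg hx.1.le, gammaPDF_of_nonneg hs.le,
    exponentialPDF_of_nonneg (sub_nonneg.2 hx.2.le), ← ENNReal.ofReal_mul (by
      have := hx.1; positivity), ← ENNReal.ofReal_mul (by positivity),
    Real.Gamma_add_one ha.ne', Real.rpow_add_one hr.ne', add_sub_cancel_right,
    show -(r * s) = -(r * x) + -(r * (s - x)) by ring, Real.exp_add]
  congr 1
  field_simp

/-- By the change of variables `x = s exp (-u / a)`. -/
lemma lintegral_Ioo_log_sub_log (ha : 0 < a) {s : ℝ} (hs : 0 < s) {F : ℝ → ℝ≥0∞}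
    (hF : Measurable F) :
    ∫⁻ x in Set.Ioo 0 s, .ofReal (a / s ^ a * x ^ (a - 1)) * F (a * (Real.log s - Real.log x)) =
      ∫⁻ u, F u ∂expMeasure 1 := by
  set φ : ℝ → ℝ := fun u => s * Real.exp (-u / a) with hφ
  have hlog : ∀ u, a * (Real.log s - Real.log (φ u)) = u := fun u => by
    rw [Real.log_mul hs.ne' (Real.exp_ne_zero _), Real.log_exp]
    field_simp
    ring
  have himage : φ '' Set.Ioi 0 = Set.Ioo 0 s := by
    ext x
    refine ⟨?_, fun ⟨h0, h1⟩ => ⟨a * (Real.log s - Real.log x),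
      mul_pos ha (sub_pos.2 (Real.log_lt_log h0 h1)), ?_⟩⟩
    · rintro ⟨u, hu, rfl⟩
      exact ⟨by positivity, mul_lt_of_lt_one_right hs
        (Real.exp_lt_one_iff.2 (div_neg_of_neg_of_pos (neg_lt_zero.2 hu) ha))⟩
    · rw [hφ]
      simp only [← mul_neg, mul_div_cancel_left₀ _ ha.ne', neg_sub, Real.exp_sub,
        Real.exp_log h0, Real.exp_log hs]
      field_simp
  have hderiv : ∀ u ∈ Set.Ioi (0 : ℝ), HasDerivWithinAt φ (-(φ u / a)) (Set.Ioi 0) u :=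
    fun u _ => (((((hasDerivAt_id u).neg).div_const a).exp.const_mul s).congr_deriv
      (by simp [hφ]; ring)).hasDerivWithinAt
  have hdensity : ∀ u, |-(φ u / a)| * (a / s ^ a * φ u ^ (a - 1)) = Real.exp (-u) := fun u => by
    have hφu : 0 < φ u := by positivity
    have hpow : φ u ^ a = s ^ a * Real.exp (-u) := by
      rw [Real.mul_rpow hs.le (Real.exp_pos _).le, ← Real.exp_mul, div_mul_cancel₀ _ ha.ne']
    rw [abs_neg, abs_of_pos (by positivity), Real.rpow_sub_one hφu.ne', hpow]
    field_simp
  have hinj : Function.Injective φ := Function.LeftInverse.injective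
    (g := fun x => a * (Real.log s - Real.log x)) hlog
  rw [← himage, lintegral_image_eq_lintegral_abs_deriv_mul measurableSet_Ioi hderiv hinj.injOn,
    lintegral_expMeasure hF]
  refine setLIntegral_congr_fun measurableSet_Ioi fun u _ => ?_
  simp only [hlog, ← mul_assoc, ← ENNReal.ofReal_mul (abs_nonneg _), hdensity, one_mul]

lemma lintegral_gammaPDF_mul_exponentialPDF_sub (ha : 0 < a) (hr : 0 < r) {s : ℝ} (hs : s ≠ 0)
    {F : ℝ → ℝ≥0∞} (hF : Measurable F) :
    ∫⁻ x, gammaPDF a r x * exponentialPDF r (s - x) * F (a * (Real.log s - Real.log x)) =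
      gammaPDF (a + 1) r s * ∫⁻ u, F u ∂expMeasure 1 := by
  have hvanish : ∀ x ∉ Set.Icc 0 s, gammaPDF a r x * exponentialPDF r (s - x) = 0 := by
    intro x hx
    rcases lt_or_ge x 0 with h0 | h0
    · rw [gammaPDF_of_neg h0, zero_mul]
    · rw [exponentialPDF_of_neg (sub_neg.2 (not_le.1 fun h => hx ⟨h0, h⟩)), mul_zero]
  rcases hs.lt_or_gt with hs | hs
  · rw [gammaPDF_of_neg hs, zero_mul]
    simp [hvanish _ fun hx => absurd (hx.1.trans hx.2) hs.not_ge]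
  · rw [← setLIntegral_eq_of_support_subset (s := Set.Icc 0 s), ← setLIntegral_congr Ioo_ae_eq_Icc,
      ← lintegral_Ioo_log_sub_log ha hs hF,
      ← lintegral_const_mul' (gammaPDF (a + 1) r s) _ ENNReal.ofReal_ne_top]
    · refine setLIntegral_congr_fun measurableSet_Ioo fun x hx => ?_
      simp only [gammaPDF_mul_exponentialPDF_sub ha hr hx, mul_assoc]
    · refine fun x => not_imp_comm.1 fun hx => ?_
      simp [hvanish x hx]

lemma lintegral_gammaMeasure_lintegral_expMeasure_add {G : ℝ → ℝ → ℝ≥0∞} (hr : 0 < r)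
    (hG : Measurable (Function.uncurry G)) :
    ∫⁻ x, ∫⁻ t, G x (x + t) ∂expMeasure r ∂gammaMeasure a r =
      ∫⁻ s, ∫⁻ x, gammaPDF a r x * exponentialPDF r (s - x) * G x s := by
  have := isProbabilityMeasure_expMeasure hr
  have hγ := measurable_gammaPDF a r
  have hexp := measurable_exponentialPDF r
  have hadd : Measurable fun p : ℝ × ℝ => G p.1 (p.1 + p.2) :=
    hG.comp (f := fun p : ℝ × ℝ => (p.1, p.1 + p.2)) (by fun_prop)
  rw [lintegral_gammaMeasure (F := fun x => ∫⁻ t, G x (x + t) ∂expMeasure r)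
    hadd.lintegral_prod_right', lintegral_lintegral_swap (by fun_prop)]
  refine lintegral_congr fun x => ?_
  rw [expMeasure, lintegral_gammaMeasure (F := fun t => G x (x + t))
    (hadd.comp measurable_prodMk_left), ← lintegral_const_mul' (gammaPDF a r x) _
    ENNReal.ofReal_ne_top, ← lintegral_add_left_eq_self (fun s => _ * G x s) x]
  simp only [add_sub_cancel_left, mul_assoc]
  rfl

theorem map_gammaMeasure_prod_expMeasure (ha : 0 < a) (hr : 0 < r) :
    ((gammaMeasure a r).prod (expMeasure r)).map
        (fun p => (a * (Real.log (p.1 + p.2) - Real.log p.1), p.1 + p.2)) =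
      (expMeasure 1).prod (gammaMeasure (a + 1) r) := by
  have := isProbabilityMeasure_gammaMeasure ha hr
  have := isProbabilityMeasure_gammaMeasure (add_pos ha one_pos) hr
  have := isProbabilityMeasure_expMeasure hr
  have := isProbabilityMeasure_expMeasure one_pos
  refine Measure.ext_of_lintegral _ fun F hF => ?_
  have hFm : Measurable fun p : ℝ × ℝ =>
    F (a * (Real.log (p.1 + p.2) - Real.log p.1), p.1 + p.2) := hF.comp (by fun_prop)
  rw [lintegral_map hF (by fun_prop), lintegral_prod _ hFm.aemeasurable]
  calc ∫⁻ x, ∫⁻ t, F (a * (Real.log (x + t) - Real.log x), x + t) ∂expMeasure r ∂gammaMeasure a r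
    _ = ∫⁻ s, ∫⁻ x, gammaPDF a r x * exponentialPDF r (s - x) *
          F (a * (Real.log s - Real.log x), s) :=
        lintegral_gammaMeasure_lintegral_expMeasure_add
          (G := fun x s => F (a * (Real.log s - Real.log x), s)) hr (hF.comp (by fun_prop))
    _ = ∫⁻ s, gammaPDF (a + 1) r s * ∫⁻ u, F (u, s) ∂expMeasure 1 := by
        refine lintegral_congr_ae ((Measure.ae_ne volume 0).mono fun s hs => ?_)
        exact lintegral_gammaPDF_mul_exponentialPDF_sub ha hr hs (hF.comp measurable_prodMk_right)
    _ = ∫⁻ p, F p ∂(expMeasure 1).prod (gammaMeasure (a + 1) r) := by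
        rw [lintegral_prod_symm _ hF.aemeasurable,
          lintegral_gammaMeasure hF.lintegral_prod_left']

lemma ae_pos_gammaMeasure (a r : ℝ) : ∀ᵐ x ∂gammaMeasure a r, 0 < x := by
  rw [gammaMeasure, ae_withDensity_iff (measurable_gammaPDF a r)]
  filter_upwards [Measure.ae_ne volume 0] with x hx hpdf
  exact hx.lt_or_gt.resolve_left fun h => hpdf (gammaPDF_of_neg h)

instance nullSingletonClass_expMeasure : NullSingletonClass (expMeasure r) :=
  nullSingletonClass_withDensity _

lemma toReal_gammaPDF_smul_cpow (ha : 0 < a) (hr : 0 < r) (s : ℂ) :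
    (fun x : ℝ => (gammaPDF a r x).toReal • (x : ℂ) ^ s) =ᵐ[volume]
      (Set.Ioi 0).indicator fun x : ℝ =>
        (r ^ a / Real.Gamma a : ℝ) * ((x : ℂ) ^ (a + s - 1) * Complex.exp (-(r * x))) := by
  filter_upwards [Measure.ae_ne volume 0] with x hx
  rcases hx.lt_or_gt with hx | hx
  · simp [gammaPDF_of_neg hx, hx.le]
  · have hpow : (x : ℂ) ^ (a + s - 1) = (x ^ (a - 1) : ℝ) * (x : ℂ) ^ s := by
      rw [Complex.ofReal_cpow hx.le, ← Complex.cpow_add _ _ (Complex.ofReal_ne_zero.2 hx.ne')]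
      push_cast
      ring_nf
    rw [gammaPDF_of_nonneg hx.le, ENNReal.toReal_ofReal (by
      have := Real.Gamma_pos_of_pos ha; positivity), Set.indicator_of_mem (Set.mem_Ioi.2 hx), hpow,
      Complex.real_smul]
    push_cast
    ring

lemma integrable_cpow_gammaMeasure (ha : 0 < a) (hr : 0 < r) {s : ℂ} (hs : -a < s.re) :
    Integrable (fun x : ℝ => (x : ℂ) ^ s) (gammaMeasure a r) := by
  rw [gammaMeasure, integrable_withDensity_iff_integrable_smul' (measurable_gammaPDF a r)
    (Eventually.of_forall fun x => ENNReal.ofReal_lt_top),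
    integrable_congr (toReal_gammaPDF_smul_cpow ha hr s),
    integrable_indicator_iff measurableSet_Ioi]
  refine Integrable.const_mul ?_ _
  have hnorm := integrableOn_rpow_mul_exp_neg_mul_rpow (s := a + s.re - 1) (p := 1) (b := r)
    (by linarith) one_pos hr
  refine (integrable_norm_iff ?_).1 (hnorm.congr_fun (fun x hx => ?_) measurableSet_Ioi)
  · fun_prop
  · have hx : 0 < x := hx
    simp [Complex.norm_cpow_eq_rpow_re_of_pos hx, Complex.norm_exp]

lemma integral_cpow_gammaMeasure (ha : 0 < a) (hr : 0 < r) {s : ℂ} (hs : -a < s.re) :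
    ∫ x : ℝ, (x : ℂ) ^ s ∂gammaMeasure a r =
      Complex.Gamma (a + s) / (Complex.Gamma a * (r : ℂ) ^ s) := by
  have hr' : (r : ℂ) ≠ 0 := Complex.ofReal_ne_zero.2 hr.ne'
  rw [gammaMeasure, integral_withDensity_eq_integral_toReal_smul (measurable_gammaPDF a r)
    (Eventually.of_forall fun x => ENNReal.ofReal_lt_top),
    integral_congr_ae (toReal_gammaPDF_smul_cpow ha hr s), integral_indicator measurableSet_Ioi,
    integral_const_mul,
    Complex.integral_cpow_mul_exp_neg_mul_Ioi (by simpa using neg_lt_iff_pos_add'.1 hs) hr,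
    one_div, Complex.inv_cpow _ _ (by
      simp [Complex.arg_ofReal_of_nonneg hr.le, Real.pi_ne_zero.symm]),
    Complex.cpow_add _ _ hr', Complex.ofReal_div, Complex.ofReal_cpow hr.le, Complex.Gamma_ofReal]
  have hra : (r : ℂ) ^ (a : ℂ) ≠ 0 := by simp [Complex.cpow_eq_zero_iff, hr']
  field_simp

lemma integrable_pow_gammaMeasure (ha : 0 < a) (hr : 0 < r) (p : ℕ) :
    Integrable (fun x : ℝ => x ^ p) (gammaMeasure a r) := by
  have h := integrable_cpow_gammaMeasure ha hr (s := p)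
    (by simpa using by linarith [p.cast_nonneg (α := ℝ)])
  simpa [← Complex.ofReal_pow] using h.re

lemma integral_pow_gammaMeasure (ha : 0 < a) (hr : 0 < r) (p : ℕ) :
    ∫ x, x ^ p ∂gammaMeasure a r = Real.Gamma (a + p) / (Real.Gamma a * r ^ p) := by
  have h := integral_cpow_gammaMeasure ha hr (s := p)
    (by simpa using by linarith [p.cast_nonneg (α := ℝ)])
  refine Complex.ofReal_injective ?_
  rw [← integral_complex_ofReal]
  simpa [← Complex.Gamma_ofReal] using h

lemma integral_id_expMeasure (hr : 0 < r) : ∫ x, x ∂expMeasure r = 1 / r := by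
  simpa [expMeasure, Real.Gamma_two, one_add_one_eq_two] using
    integral_pow_gammaMeasure one_pos hr 1

lemma memLp_id_expMeasure (hr : 0 < r) : MemLp id 2 (expMeasure r) :=
  (memLp_two_iff_integrable_sq aestronglyMeasurable_id).2 (integrable_pow_gammaMeasure one_pos hr 2)

lemma variance_id_expMeasure (hr : 0 < r) : Var[id; expMeasure r] = 1 / r ^ 2 := by
  have := isProbabilityMeasure_expMeasure hr
  have hsq : ∫ x, x ^ 2 ∂expMeasure r = 2 / r ^ 2 := by
    rw [expMeasure, integral_pow_gammaMeasure one_pos hr, Real.Gamma_one, one_mul,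
      Nat.cast_ofNat, show (1 : ℝ) + 2 = (2 : ℕ) + 1 by norm_num, Real.Gamma_nat_eq_factorial]
    norm_num
  rw [variance_eq_sub (memLp_id_expMeasure hr)]
  simp only [id, Pi.pow_apply, hsq, integral_id_expMeasure hr]
  ring

end GammaLaw

section FinPower

variable {α : Type*} [MeasurableSpace α] {n : ℕ}

lemma measurePreserving_comp_perm_pi (ν : Measure α) [SigmaFinite ν]
    (σ : Equiv.Perm (Fin n)) :
    MeasurePreserving (fun x => x ∘ σ) (Measure.pi fun _ : Fin n => ν)
      (Measure.pi fun _ : Fin n => ν) := by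
  convert measurePreserving_piCongrLeft (fun _ => ν) σ.symm using 1
  ext x i
  simp [MeasurableEquiv.coe_piCongrLeft, Equiv.piCongrLeft_apply]

lemma ae_injective_pi [TopologicalSpace α] [T2Space α] [SecondCountableTopology α]
    [OpensMeasurableSpace α] (ν : Measure α) [IsProbabilityMeasure ν] [NullSingletonClass ν] :
    ∀ᵐ x ∂Measure.pi (fun _ : Fin n => ν), Function.Injective x := by
  have hdiag : ∀ᵐ p ∂ν.prod ν, p.1 ≠ p.2 := by
    have hm : MeasurableSet {p : α × α | p.1 = p.2} := isClosed_diagonal.measurableSet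
    rw [ae_iff]
    simp only [ne_eq, not_not]
    rw [Measure.measure_prod_null hm]
    exact .of_forall fun a => by simp [Set.preimage]
  have hne : ∀ i j : Fin n, i ≠ j → ∀ᵐ x ∂Measure.pi (fun _ : Fin n => ν), x i ≠ x j := by
    intro i j hij
    have hindep : IndepFun (fun x : Fin n → α => x i) (fun x => x j) (Measure.pi fun _ => ν) :=
      (iIndepFun_pi (X := fun _ => id) fun _ => aemeasurable_id).indepFun hij
    have heval : ∀ i : Fin n, (Measure.pi fun _ : Fin n => ν).map (fun x => x i) = ν := fun i =>
      (measurePreserving_eval (fun _ : Fin n => ν) i).map_eq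
    rw [indepFun_iff_map_prod_eq_prod_map_map (measurable_pi_apply i).aemeasurable
      (measurable_pi_apply j).aemeasurable, heval, heval] at hindep
    exact ae_of_ae_map (f := fun x : Fin n → α => (x i, x j)) (by fun_prop) (hindep.symm ▸ hdiag)
  have hall : ∀ᵐ x ∂Measure.pi (fun _ : Fin n => ν), ∀ i j, i ≠ j → x i ≠ x j := by
    simpa only [ae_all_iff, eventually_imp_distrib_left]
  exact hall.mono fun x hx i j => not_imp_not.1 (hx i j)

end FinPower

/-- The decreasing rearrangement of a tuple. -/
def decreasingRearrangement {α : Type*} [LinearOrder α] {n : ℕ} (x : Fin n → α) : Fin n → α :=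
  x ∘ Tuple.sort x ∘ Fin.rev

section OrderStatistics

variable {α : Type*} [LinearOrder α] {n : ℕ}

lemma antitone_decreasingRearrangement (x : Fin n → α) : Antitone (decreasingRearrangement x) :=
  fun _ _ h => Tuple.monotone_sort x (Fin.rev_le_rev.2 h)

lemma decreasingRearrangement_eq_of_antitone {x : Fin n → α} {σ : Equiv.Perm (Fin n)}
    (h : Antitone (x ∘ σ)) : decreasingRearrangement x = x ∘ σ :=
  Tuple.unique_antitone (σ := Fin.revPerm.trans (Tuple.sort x)) (antitone_decreasingRearrangement x)
    h

lemma sum_indicator_strictAnti_comp_perm {x : Fin n → α} (hx : Function.Injective x)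
    (F : (Fin n → α) → ℝ≥0∞) :
    ∑ σ : Equiv.Perm (Fin n), {y : Fin n → α | StrictAnti y}.indicator F (x ∘ σ) =
      F (decreasingRearrangement x) := by
  rw [Finset.sum_eq_single (Fin.revPerm.trans (Tuple.sort x))]
  · refine Set.indicator_of_mem ?_ F
    exact (antitone_decreasingRearrangement x).strictAnti_of_injective
      (hx.comp (Equiv.injective (Fin.revPerm.trans (Tuple.sort x))))
  · refine fun σ _ hσ => Set.indicator_of_notMem (fun hanti : StrictAnti (x ∘ σ) => hσ ?_) F
    refine Equiv.ext fun i => hx ?_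
    exact (congrFun (decreasingRearrangement_eq_of_antitone hanti.antitone) i).symm
  · simp

variable [TopologicalSpace α] [OrderClosedTopology α] [SecondCountableTopology α]
  [MeasurableSpace α] [OpensMeasurableSpace α]

lemma measurableSet_setOf_strictAnti : MeasurableSet {x : Fin n → α | StrictAnti x} := by
  simp only [StrictAnti]
  measurability

lemma measurableSet_setOf_tupleSort_eq (σ : Equiv.Perm (Fin n)) :
    MeasurableSet {x : Fin n → α | Tuple.sort x = σ} := by
  have hsort : {x : Fin n → α | Tuple.sort x = σ} = {x | (∀ i j, i ≤ j → x (σ i) ≤ x (σ j)) ∧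
      ∀ i j, i < j → x (σ i) = x (σ j) → σ i < σ j} := by
    ext x
    exact eq_comm.trans Tuple.eq_sort_iff
  rw [hsort]
  measurability

lemma measurable_decreasingRearrangement :
    Measurable (decreasingRearrangement : (Fin n → α) → Fin n → α) := by
  refine measurable_pi_lambda _ fun k B hB => ?_
  have hpre : (fun x : Fin n → α => decreasingRearrangement x k) ⁻¹' B =
      ⋃ σ, {x | Tuple.sort x = σ} ∩ (fun x => x (σ k.rev)) ⁻¹' B := by
    ext x
    simp [decreasingRearrangement]
  rw [hpre]
  exact .iUnion fun σ => (measurableSet_setOf_tupleSort_eq σ).inter (measurable_pi_apply _ hB)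

theorem map_decreasingRearrangement_pi (ν : Measure α) [IsProbabilityMeasure ν]
    [NullSingletonClass ν] :
    (Measure.pi (fun _ : Fin n => ν)).map decreasingRearrangement =
      (n.factorial : ℝ≥0∞) • (Measure.pi (fun _ : Fin n => ν)).restrict {x | StrictAnti x} := by
  set μ := Measure.pi (fun _ : Fin n => ν)
  refine Measure.ext_of_lintegral _ fun F hF => ?_
  have hFm := hF.indicator (measurableSet_setOf_strictAnti (α := α) (n := n))
  calc ∫⁻ x, F x ∂μ.map decreasingRearrangement
    _ = ∫⁻ x, F (decreasingRearrangement x) ∂μ :=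
        lintegral_map hF measurable_decreasingRearrangement
    _ = ∫⁻ x, ∑ σ : Equiv.Perm (Fin n), {y | StrictAnti y}.indicator F (x ∘ σ) ∂μ := by
        refine lintegral_congr_ae ((ae_injective_pi ν).mono fun x hx => ?_)
        exact (sum_indicator_strictAnti_comp_perm hx F).symm
    _ = ∑ σ : Equiv.Perm (Fin n), ∫⁻ x, {y | StrictAnti y}.indicator F x ∂μ := by
        have hσm (σ : Equiv.Perm (Fin n)) : Measurable fun x : Fin n → α => x ∘ σ := by fun_prop
        refine (lintegral_finsetSum _ fun σ _ => hFm.comp (hσm σ)).trans ?_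
        exact Finset.sum_congr rfl fun σ _ =>
          (measurePreserving_comp_perm_pi ν σ).lintegral_comp hFm
    _ = ∫⁻ x, F x ∂((n.factorial : ℝ≥0∞) • μ.restrict {x | StrictAnti x}) := by
        rw [lintegral_indicator measurableSet_setOf_strictAnti, lintegral_smul_measure]
        simp [Fintype.card_perm]

end OrderStatistics

section ProductDensity

variable {α : Type*} [MeasurableSpace α] {n : ℕ}

lemma lintegral_pi_prod (μ : Fin n → Measure α) [∀ i, SigmaFinite (μ i)]
    {f : Fin n → α → ℝ≥0∞} (hf : ∀ i, Measurable (f i)) :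
    ∫⁻ x, ∏ i, f i (x i) ∂Measure.pi μ = ∏ i, ∫⁻ x, f i x ∂μ i := by
  induction n with
  | zero => simp
  | succ n ih =>
    have htail : Measurable fun x : Fin n → α => ∏ i : Fin n, f i.succ (x i) :=
      Finset.measurable_fun_prod _ fun i _ => (hf _).comp (measurable_pi_apply i)
    rw [← (measurePreserving_piFinSuccAbove μ 0).symm.lintegral_comp_emb
      (MeasurableEquiv.measurableEmbedding _)]
    simp only [MeasurableEquiv.piFinSuccAbove_symm_apply, Fin.insertNthEquiv, Equiv.coe_fn_mk,
      Fin.prod_univ_succ, Fin.insertNth_zero, Fin.cons_zero, Fin.cons_succ, Fin.succAbove_zero]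
    exact (lintegral_prod_mul (hf 0).aemeasurable htail.aemeasurable).trans
      (congrArg _ (ih (fun i => μ i.succ) fun i => hf i.succ))

lemma pi_withDensity (μ : Measure α) [SigmaFinite μ] {f : α → ℝ≥0∞} (hf : Measurable f)
    [SigmaFinite (μ.withDensity f)] :
    Measure.pi (fun _ : Fin n => μ.withDensity f) =
      (Measure.pi fun _ : Fin n => μ).withDensity fun x => ∏ i, f (x i) := by
  refine Measure.pi_eq fun s hs => ?_
  rw [withDensity_apply _ (MeasurableSet.univ_pi hs), Measure.restrict_pi_pi,
    lintegral_pi_prod _ fun _ => hf]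
  exact Finset.prod_congr rfl fun i _ => (withDensity_apply _ (hs i)).symm

end ProductDensity

/-- The matrix of the map `x ↦ (∑ j ≥ k, x j / (j + 1))ₖ` which takes the normalized spacings of
a decreasing tuple to the tuple itself. -/
noncomputable def tailMatrix (n : ℕ) : Matrix (Fin n) (Fin n) ℝ :=
  Matrix.of fun k j => if k ≤ j then ((j : ℝ) + 1)⁻¹ else 0

section Renyi

variable {n : ℕ} {r : ℝ}

lemma det_tailMatrix (n : ℕ) : (tailMatrix n).det = (n.factorial : ℝ)⁻¹ := by
  have htri : (tailMatrix n).IsUpperTriangular := fun i j (hij : j < i) => by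
    simp [tailMatrix, hij]
  rw [Matrix.det_of_isUpperTriangular htri, ← Finset.prod_range_add_one_eq_factorial]
  simp [tailMatrix, Finset.prod_range]

lemma toLin'_tailMatrix (x : Fin n → ℝ) (k : Fin n) :
    Matrix.toLin' (tailMatrix n) x k = ∑ j ∈ Finset.Ici k, x j / ((j : ℝ) + 1) := by
  simp [tailMatrix, Matrix.mulVec, dotProduct, Finset.sum_filter, ← Finset.filter_le_eq_Ici,
    div_eq_inv_mul]

lemma sum_toLin'_tailMatrix (x : Fin n → ℝ) :
    ∑ k, Matrix.toLin' (tailMatrix n) x k = ∑ j, x j := by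
  calc ∑ k, Matrix.toLin' (tailMatrix n) x k
    _ = ∑ k, ∑ j ∈ Finset.Ici k, x j / ((j : ℝ) + 1) := by simp only [toLin'_tailMatrix]
    _ = ∑ j, ∑ _k ∈ Finset.Iic j, x j / ((j : ℝ) + 1) :=
        Finset.sum_comm' (by simp)
    _ = ∑ j, x j := by
        refine Finset.sum_congr rfl fun j _ => ?_
        rw [Finset.sum_const, Fin.card_Iic, nsmul_eq_mul, Nat.cast_succ, mul_div_cancel₀]
        positivity

lemma strictAnti_toLin'_tailMatrix {x : Fin n → ℝ} (hx : ∀ i, 0 < x i) :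
    StrictAnti (Matrix.toLin' (tailMatrix n) x) := by
  intro k l hkl
  rw [toLin'_tailMatrix, toLin'_tailMatrix]
  refine Finset.sum_lt_sum_of_subset (Finset.Ici_subset_Ici.2 hkl.le) (Finset.mem_Ici.2 le_rfl)
    (by simpa using hkl) (div_pos (hx k) (by positivity)) fun j _ _ => ?_
  exact div_nonneg (hx j).le (by positivity)

lemma prod_exponentialPDF_of_nonneg {x : Fin n → ℝ} (hr : 0 ≤ r) (hx : ∀ i, 0 ≤ x i) :
    ∏ i, exponentialPDF r (x i) = ENNReal.ofReal (r ^ n * Real.exp (-(r * ∑ i, x i))) := by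
  simp only [exponentialPDF_of_nonneg (hx _)]
  rw [← ENNReal.ofReal_prod_of_nonneg fun i _ => by positivity, Finset.prod_mul_distrib,
    ← Real.exp_sum]
  simp [Finset.mul_sum]

lemma prod_exponentialPDF_le_indicator_toLin'_tailMatrix (hr : 0 ≤ r) {x : Fin n → ℝ}
    (hx : ∀ i, x i ≠ 0) :
    ∏ i, exponentialPDF r (x i) ≤
      {y : Fin n → ℝ | StrictAnti y}.indicator (fun y => ∏ i, exponentialPDF r (y i))
        (Matrix.toLin' (tailMatrix n) x) := by
  by_cases hpos : ∀ i, 0 < x i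
  · have hnonneg : ∀ k, 0 ≤ Matrix.toLin' (tailMatrix n) x k := fun k => by
      rw [toLin'_tailMatrix]
      exact Finset.sum_nonneg fun j _ => div_nonneg (hpos j).le (by positivity)
    rw [Set.indicator_of_mem (show _ ∈ {y | StrictAnti y} from strictAnti_toLin'_tailMatrix hpos),
      prod_exponentialPDF_of_nonneg hr fun i => (hpos i).le,
      prod_exponentialPDF_of_nonneg hr hnonneg, sum_toLin'_tailMatrix]
  · obtain ⟨i, hi⟩ := not_forall.1 hpos
    have hneg : x i < 0 := (not_lt.1 hi).lt_of_ne (hx i)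
    rw [Finset.prod_eq_zero (Finset.mem_univ i) (exponentialPDF_of_neg hneg)]
    exact zero_le

lemma measurable_toLin'_tailMatrix : Measurable (Matrix.toLin' (tailMatrix n)) :=
  (LinearMap.continuous_of_finiteDimensional _).measurable

lemma pi_expMeasure (hr : 0 < r) :
    Measure.pi (fun _ : Fin n => expMeasure r) =
      volume.withDensity fun x => ∏ i, exponentialPDF r (x i) :=
  have := isProbabilityMeasure_expMeasure hr
  have : SigmaFinite (volume.withDensity (exponentialPDF r)) :=
    inferInstanceAs (SigmaFinite (expMeasure r))
  pi_withDensity (f := exponentialPDF r) volume (measurable_exponentialPDF r)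

lemma map_tailMatrix_pi_expMeasure_le (hr : 0 < r) :
    (Measure.pi fun _ : Fin n => expMeasure r).map (Matrix.toLin' (tailMatrix n)) ≤
      (Measure.pi fun _ : Fin n => expMeasure r).map decreasingRearrangement := by
  have := isProbabilityMeasure_expMeasure hr
  set f : (Fin n → ℝ) → ℝ≥0∞ := fun x => ∏ i, exponentialPDF r (x i)
  set q := {y : Fin n → ℝ | StrictAnti y}.indicator f
  have hf : Measurable f :=
    Finset.measurable_fun_prod _ fun i _ => (measurable_exponentialPDF r).comp
      (measurable_pi_apply i)
  have hq : Measurable q := hf.indicator measurableSet_setOf_strictAnti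
  have hfq : ∀ᵐ x : Fin n → ℝ, f x ≤ q (Matrix.toLin' (tailMatrix n) x) := by
    have hne : ∀ᵐ x : Fin n → ℝ, ∀ i, x i ≠ 0 := ae_all_iff.2 fun i =>
      Measure.ae_eval_ne (μ := fun _ : Fin n => (volume : Measure ℝ)) i 0
    exact hne.mono fun x hx => prod_exponentialPDF_le_indicator_toLin'_tailMatrix hr.le hx
  have hvol : (volume : Measure (Fin n → ℝ)).map (Matrix.toLin' (tailMatrix n)) =
      (n.factorial : ℝ≥0∞) • volume := by
    rw [Real.map_matrix_volume_pi_eq_smul_volume_pi (by simp [det_tailMatrix, n.factorial_ne_zero]),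
      det_tailMatrix, inv_inv, Nat.abs_cast, ENNReal.ofReal_natCast]
  rw [map_decreasingRearrangement_pi, pi_expMeasure hr,
    restrict_withDensity measurableSet_setOf_strictAnti,
    ← withDensity_indicator measurableSet_setOf_strictAnti, ← withDensity_smul_measure, ← hvol]
  refine Measure.le_iff.2 fun A hA => ?_
  have hA' := measurable_toLin'_tailMatrix hA
  rw [Measure.map_apply measurable_toLin'_tailMatrix hA, withDensity_apply _ hA',
    withDensity_apply _ hA, setLIntegral_map hA hq measurable_toLin'_tailMatrix]
  exact lintegral_mono_ae (ae_restrict_of_ae hfq)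

/-- **Rényi's representation** of the order statistics of independent exponential variables. -/
theorem map_decreasingRearrangement_pi_expMeasure (hr : 0 < r) :
    (Measure.pi fun _ : Fin n => expMeasure r).map decreasingRearrangement =
      (Measure.pi fun _ : Fin n => expMeasure r).map (Matrix.toLin' (tailMatrix n)) := by
  have := isProbabilityMeasure_expMeasure hr
  have := Measure.isProbabilityMeasure_map (μ := Measure.pi fun _ : Fin n => expMeasure r)
    measurable_decreasingRearrangement.aemeasurable
  have := Measure.isProbabilityMeasure_map (μ := Measure.pi fun _ : Fin n => expMeasure r)
    (measurable_toLin'_tailMatrix (n := n)).aemeasurable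
  exact (Measure.eq_of_le_of_isProbabilityMeasure (map_tailMatrix_pi_expMeasure_le hr)).symm

end Renyi

lemma indepFun_eval_infinitePi_of_dependsOn {ι β : Type*} {X : ι → Type*}
    [∀ i, MeasurableSpace (X i)] [MeasurableSpace β] (μ : ∀ i, Measure (X i))
    [∀ i, IsProbabilityMeasure (μ i)] {f : (∀ i, X i) → β} (hf : Measurable f) {s : Finset ι}
    (hs : DependsOn f s) {i : ι} (hi : i ∉ s) :
    IndepFun f (fun x => x i) (Measure.infinitePi μ) := by
  classical
  have (i : ι) : Nonempty (X i) := nonempty_of_isProbabilityMeasure (μ i)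
  let x₀ : ∀ i, X i := Classical.ofNonempty
  have hcoord : iIndepFun (fun i (x : ∀ i, X i) => x i) (Measure.infinitePi μ) :=
    iIndepFun_infinitePi (X := fun _ x => x) fun _ => measurable_id
  have hrestrict := hcoord.indepFun_finset s {i} (by simpa) fun i => measurable_pi_apply i
  have hfactor : f = (f ∘ Function.updateFinset x₀ s) ∘ fun x (i : s) => x i :=
    funext fun x => hs fun j hj => by simp [Function.updateFinset, Finset.mem_coe.1 hj]
  rw [hfactor]
  exact hrestrict.comp (hf.comp measurable_updateFinset)
    (measurable_pi_apply (⟨i, Finset.mem_singleton_self i⟩ : ({i} : Finset ι)))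

instance isProbabilityMeasure_expMeasure_one : IsProbabilityMeasure (expMeasure 1) :=
  isProbabilityMeasure_expMeasure one_pos

/-- The law of a sequence of independent `Exp(1)` variables. -/
noncomputable def expSeq : Measure (ℕ → ℝ) := Measure.infinitePi fun _ => expMeasure 1

instance isProbabilityMeasure_expSeq : IsProbabilityMeasure expSeq := by
  unfold expSeq; infer_instance

lemma hasLaw_eval_expSeq (i : ℕ) : HasLaw (fun x : ℕ → ℝ => x i) (expMeasure 1) expSeq :=
  (measurePreserving_eval_infinitePi (fun _ : ℕ => expMeasure 1) i).hasLaw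

lemma iIndepFun_eval_expSeq : iIndepFun (fun (i : ℕ) (x : ℕ → ℝ) => x i) expSeq :=
  iIndepFun_infinitePi (X := fun _ x => x) fun _ => measurable_id

lemma hasLaw_restrict_expSeq (n : ℕ) :
    HasLaw (fun (x : ℕ → ℝ) (i : Fin n) => x i) (Measure.pi fun _ => expMeasure 1) expSeq :=
  (iIndepFun_eval_expSeq.precomp Fin.val_injective).hasLaw_pi fun i => hasLaw_eval_expSeq i

lemma ae_pos_expSeq : ∀ᵐ x ∂expSeq, ∀ i, 0 < x i :=
  ae_all_iff.2 fun i => ((hasLaw_eval_expSeq i).ae_iff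
    (measurableSet_setOfPred.1 measurableSet_Ioi)).2 (ae_pos_gammaMeasure 1 1)

section LargestOfExp

/-- The sums `∑ k ≤ j < n, x j / (j + 1)`, as a function of `k`: for independent `Exp(1)` variables
`x j`, this is Rényi's representation of the `(k + 1)`-st largest of `n` such variables. -/
noncomputable def harmonicTail (n : ℕ) (x : ℕ → ℝ) (k : ℕ) : ℝ :=
  ∑ j ∈ Finset.Ico k n, x j / ((j : ℝ) + 1)

/-- The extension of a tuple by zeros to a sequence. -/
def extendByZero {n : ℕ} (y : Fin n → ℝ) (k : ℕ) : ℝ := if h : k < n then y ⟨k, h⟩ else 0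

lemma measurable_extendByZero {n : ℕ} : Measurable (extendByZero (n := n)) := by
  refine measurable_pi_lambda _ fun k => ?_
  by_cases h : k < n
  · simpa [extendByZero, h] using measurable_pi_apply _
  · simp [extendByZero, h]

lemma kthLargest_eq_extendByZero (n : ℕ) (x : ℕ → ℝ) :
    (fun k => kthLargest n k x) = extendByZero (decreasingRearrangement fun i : Fin n => x i) :=
  rfl

lemma harmonicTail_eq_extendByZero (n : ℕ) (x : ℕ → ℝ) :
    harmonicTail n x = extendByZero (Matrix.toLin' (tailMatrix n) fun i : Fin n => x i) := by
  funext k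
  by_cases h : k < n
  · simp only [harmonicTail, extendByZero, h, dite_true, toLin'_tailMatrix]
    rw [← Fin.map_valEmbedding_Ici ⟨k, h⟩, Finset.sum_map]
    rfl
  · simp [harmonicTail, extendByZero, h, Finset.Ico_eq_empty_of_le (not_lt.1 h)]

lemma measurable_kthLargest (n : ℕ) : Measurable fun (x : ℕ → ℝ) k => kthLargest n k x :=
  (measurable_extendByZero.comp measurable_decreasingRearrangement).comp
    (f := fun (x : ℕ → ℝ) (i : Fin n) => x i) (by fun_prop)

@[fun_prop]
lemma measurable_harmonicTail (n : ℕ) : Measurable (harmonicTail n) := by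
  unfold harmonicTail
  fun_prop

theorem map_kthLargest_expSeq (n : ℕ) :
    expSeq.map (fun x k => kthLargest n k x) = expSeq.map (harmonicTail n) := by
  have hrestrict : Measurable fun (x : ℕ → ℝ) (i : Fin n) => x i := by fun_prop
  have hmap {f : (Fin n → ℝ) → Fin n → ℝ} (hf : Measurable f) :
      expSeq.map (fun x => extendByZero (f fun i : Fin n => x i)) =
        ((Measure.pi fun _ => expMeasure 1).map f).map extendByZero := by
    rw [← (hasLaw_restrict_expSeq n).map_eq, Measure.map_map hf hrestrict,
      Measure.map_map measurable_extendByZero (hf.comp hrestrict)]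
    rfl
  rw [funext (kthLargest_eq_extendByZero n), funext (harmonicTail_eq_extendByZero n),
    hmap measurable_decreasingRearrangement, hmap measurable_toLin'_tailMatrix,
    map_decreasingRearrangement_pi_expMeasure one_pos]

end LargestOfExp

section LogIncrements

lemma hasLaw_prodMk_log_add_sub_log {Ω E : Type*} [MeasurableSpace Ω] [MeasurableSpace E]
    {P : Measure Ω} {μ : Measure E} [IsProbabilityMeasure μ] {a r : ℝ} (ha : 0 < a) (hr : 0 < r)
    {A : Ω → E} {X T : Ω → ℝ} (hAX : HasLaw (fun ω => (A ω, X ω)) (μ.prod (gammaMeasure a r)) P)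
    (hT : HasLaw T (expMeasure r) P) (hindep : IndepFun (fun ω => (A ω, X ω)) T P) :
    HasLaw (fun ω => ((a * (Real.log (X ω + T ω) - Real.log (X ω)), A ω), X ω + T ω))
      (((expMeasure 1).prod μ).prod (gammaMeasure (a + 1) r)) P := by
  have := isProbabilityMeasure_gammaMeasure ha hr
  have := isProbabilityMeasure_gammaMeasure (add_pos ha one_pos) hr
  have := isProbabilityMeasure_expMeasure hr
  have := hAX.isProbabilityMeasure
  have hstep : MeasurePreserving
      (fun p : ℝ × ℝ => (a * (Real.log (p.1 + p.2) - Real.log p.1), p.1 + p.2))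
      ((gammaMeasure a r).prod (expMeasure r)) ((expMeasure 1).prod (gammaMeasure (a + 1) r)) :=
    ⟨by fun_prop, map_gammaMeasure_prod_expMeasure ha hr⟩
  have hswap : MeasurePreserving (fun q : E × (ℝ × ℝ) => ((q.2.1, q.1), q.2.2))
      (μ.prod ((expMeasure 1).prod (gammaMeasure (a + 1) r)))
      (((expMeasure 1).prod μ).prod (gammaMeasure (a + 1) r)) :=
    (Measure.measurePreserving_swap.prod (.id _)).comp
      (measurePreserving_prodAssoc μ (expMeasure 1) (gammaMeasure (a + 1) r)).symm
  have hassoc := measurePreserving_prodAssoc μ (gammaMeasure a r) (expMeasure r)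
  exact ((hswap.comp ((MeasurePreserving.id μ).prod hstep)).comp hassoc).hasLaw.comp
    (hindep.hasLaw_prod hAX hT)

/-- The rescaled logarithmic increments of the partial sums `x 0 + … + x n`: they are independent
`Exp(1)` variables if the `x j` are, and their harmonic tails telescope. -/
noncomputable def logIncr (x : ℕ → ℝ) (j : ℕ) : ℝ :=
  (j + 1) * (Real.log (∑ i ∈ Finset.range (j + 2), x i) -
    Real.log (∑ i ∈ Finset.range (j + 1), x i))

@[fun_prop]
lemma measurable_logIncr : Measurable logIncr := by
  unfold logIncr
  fun_prop

lemma dependsOn_logIncr_sum (n : ℕ) :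
    DependsOn (fun x => (fun i : Fin n => logIncr x i, ∑ i ∈ Finset.range (n + 1), x i))
      (Finset.range (n + 1) : Set ℕ) := by
  intro x y hxy
  have hsum : ∀ k ≤ n, ∑ i ∈ Finset.range (k + 1), x i = ∑ i ∈ Finset.range (k + 1), y i :=
    fun k hk => Finset.sum_congr rfl fun i hi => hxy i (Finset.range_mono (by lia) hi)
  refine Prod.ext (funext fun i => ?_) (hsum n le_rfl)
  simp only [logIncr]
  rw [hsum i i.2.le, hsum (i + 1) i.2]

theorem hasLaw_logIncr_sum (n : ℕ) :
    HasLaw (fun x => (fun i : Fin n => logIncr x i, ∑ i ∈ Finset.range (n + 1), x i))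
      ((Measure.pi fun _ => expMeasure 1).prod (gammaMeasure (n + 1) 1)) expSeq := by
  induction n with
  | zero =>
    have hempty : HasLaw (fun (x : ℕ → ℝ) (i : Fin 0) => logIncr x i)
        (Measure.pi fun _ => expMeasure 1) expSeq := by
      rw [Measure.pi_of_empty (x := Fin.elim0)]
      exact hasLaw_dirac_of_ae_eq (ae_of_all _ fun x => Subsingleton.elim _ _)
    have heval : HasLaw (fun x : ℕ → ℝ => ∑ i ∈ Finset.range (0 + 1), x i)
        (gammaMeasure ((0 : ℕ) + 1) 1) expSeq := by
      simpa [expMeasure] using hasLaw_eval_expSeq 0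
    refine IndepFun.hasLaw_prod hempty heval ?_
    convert indepFun_const_left (μ := expSeq) (Fin.elim0 : Fin 0 → ℝ) _
  | succ n ih =>
    have hindep := indepFun_eval_infinitePi_of_dependsOn (fun _ : ℕ => expMeasure 1)
      (f := fun x => (fun i : Fin n => logIncr x i, ∑ i ∈ Finset.range (n + 1), x i))
      (by fun_prop) (dependsOn_logIncr_sum n)
      Finset.notMem_range_self
    have hstep := hasLaw_prodMk_log_add_sub_log (by positivity) one_pos ih
      (hasLaw_eval_expSeq (n + 1)) hindep
    have := isProbabilityMeasure_gammaMeasure (a := n + 1 + 1) (by positivity) one_pos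
    have hsnoc := (measurePreserving_piFinSuccAbove (fun _ => expMeasure 1) (Fin.last n)).symm
    have h := (hsnoc.prod (.id (gammaMeasure (n + 1 + 1) 1))).hasLaw.comp hstep
    push_cast
    convert h using 1
    ext x i
    · induction i using Fin.lastCases <;> simp [logIncr, ← Finset.sum_range_succ]
    · simp [Finset.sum_range_succ]

theorem hasLaw_logIncr : HasLaw logIncr expSeq expSeq := by
  refine ⟨measurable_logIncr.aemeasurable, Measure.eq_infinitePi _ fun s t ht => ?_⟩
  obtain ⟨n, hn⟩ := s.exists_nat_subset_range
  have := isProbabilityMeasure_gammaMeasure (a := n + 1) (by positivity) one_pos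
  have hlaw : HasLaw (fun x (i : Fin n) => logIncr x i) (Measure.pi fun _ => expMeasure 1) expSeq :=
    measurePreserving_fst.hasLaw.comp (hasLaw_logIncr_sum n)
  let u : ℕ → Set ℝ := fun i => if i ∈ s then t i else Set.univ
  have hu (i : ℕ) : MeasurableSet (u i) := by
    unfold u
    split_ifs with hi
    exacts [ht i, .univ]
  have hpre : logIncr ⁻¹' (s : Set ℕ).pi t =
      (fun x (i : Fin n) => logIncr x i) ⁻¹' Set.univ.pi fun i : Fin n => u i := by
    ext x
    simp only [Set.mem_preimage, Set.mem_pi, u]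
    refine ⟨fun hx i _ => ?_, fun hx i hi => ?_⟩
    · split_ifs with hi
      exacts [hx i hi, trivial]
    · simpa [Finset.mem_coe.1 hi] using hx ⟨i, Finset.mem_range.1 (hn hi)⟩ trivial
  rw [Measure.map_apply measurable_logIncr (.pi s.countable_toSet fun i _ => ht i), hpre,
    ← Measure.map_apply_of_aemeasurable hlaw.aemeasurable (.univ_pi fun i => hu i), hlaw.map_eq,
    Measure.pi_pi,
    Fin.prod_univ_eq_prod_range (fun i => expMeasure 1 (u i)), ← Finset.prod_subset hn]
  · exact Finset.prod_congr rfl fun i hi => by simp [u, hi]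
  · exact fun i _ hi => by simp [u, hi]

lemma hasLaw_sum_expSeq (n : ℕ) :
    HasLaw (fun x : ℕ → ℝ => ∑ i ∈ Finset.range (n + 1), x i) (gammaMeasure (n + 1) 1) expSeq :=
  have := isProbabilityMeasure_gammaMeasure (a := n + 1) (by positivity) one_pos
  (measurePreserving_snd.hasLaw).comp (hasLaw_logIncr_sum n)

lemma indepFun_logIncr_sum (n : ℕ) :
    IndepFun (fun x (i : Fin n) => logIncr x i) (fun x => ∑ i ∈ Finset.range (n + 1), x i)
      expSeq :=
  have := isProbabilityMeasure_gammaMeasure (a := n + 1) (by positivity) one_pos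
  (indepFun_iff_hasLaw_prodMk_prod (measurePreserving_fst.hasLaw.comp (hasLaw_logIncr_sum n))
    (hasLaw_sum_expSeq n)).2 (hasLaw_logIncr_sum n)

end LogIncrements

section LaplaceTransforms

lemma cexp_mul_neg_log {x : ℝ} (hx : 0 < x) (s : ℂ) :
    Complex.exp (s * (-Real.log x : ℝ)) = (x : ℂ) ^ (-s) := by
  rw [Complex.cpow_def_of_ne_zero (Complex.ofReal_ne_zero.2 hx.ne'), ← Complex.ofReal_log hx.le]
  push_cast
  ring_nf

lemma integrable_cexp_mul_neg_log_gammaMeasure {a r : ℝ} (ha : 0 < a) (hr : 0 < r) {s : ℂ}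
    (hs : s.re < a) :
    Integrable (fun x : ℝ => Complex.exp (s * (-Real.log x : ℝ))) (gammaMeasure a r) :=
  (integrable_cpow_gammaMeasure ha hr (s := -s) (by simpa using hs)).congr <| by
    filter_upwards [ae_pos_gammaMeasure a r] with x hx using (cexp_mul_neg_log hx s).symm

lemma integral_cexp_mul_neg_log_gammaMeasure {a r : ℝ} (ha : 0 < a) (hr : 0 < r) {s : ℂ}
    (hs : s.re < a) :
    ∫ x : ℝ, Complex.exp (s * (-Real.log x : ℝ)) ∂gammaMeasure a r =
      Complex.Gamma (a - s) / (Complex.Gamma a * (r : ℂ) ^ (-s)) := by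
  rw [sub_eq_add_neg, ← integral_cpow_gammaMeasure ha hr (by simpa using hs)]
  refine integral_congr_ae ?_
  filter_upwards [ae_pos_gammaMeasure a r] with x hx using cexp_mul_neg_log hx s

/-- The limiting sequence: `-log (x 0), -log (x 0 + x 1), …`. -/
noncomputable def negLogSum (x : ℕ → ℝ) (k : ℕ) : ℝ :=
  -Real.log (∑ i ∈ Finset.range (k + 1), x i)

@[fun_prop]
lemma measurable_negLogSum : Measurable negLogSum := by
  unfold negLogSum
  fun_prop

lemma hasLaw_negLogSum (k : ℕ) :
    HasLaw (fun x => negLogSum x k) ((gammaMeasure (k + 1) 1).map fun x => -Real.log x) expSeq :=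
  HasLaw.fun_comp (Y := fun x : ℝ => -Real.log x)
    ⟨Measurable.aemeasurable (by fun_prop), rfl⟩ (hasLaw_sum_expSeq k)

lemma harmonicTail_logIncr {n k : ℕ} (hk : k ≤ n) (x : ℕ → ℝ) :
    harmonicTail n (logIncr x) k = negLogSum x k - negLogSum x n := by
  have hterm (j : ℕ) : logIncr x j / ((j : ℝ) + 1) =
      Real.log (∑ i ∈ Finset.range (j + 1 + 1), x i) -
        Real.log (∑ i ∈ Finset.range (j + 1), x i) :=
    mul_div_cancel_left₀ _ (by positivity)
  simp only [harmonicTail, hterm, negLogSum]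
  rw [Finset.sum_Ico_sub (fun m => Real.log (∑ i ∈ Finset.range (m + 1), x i)) hk]
  ring

lemma identDistrib_cexp_mul_negLogSum (k : ℕ) (s : ℂ) :
    IdentDistrib (fun x => Complex.exp (s * (negLogSum x k : ℝ)))
      (fun x : ℝ => Complex.exp (s * (-Real.log x : ℝ))) expSeq (gammaMeasure (k + 1) 1) :=
  ((hasLaw_sum_expSeq k).identDistrib HasLaw.id).comp
    (u := fun x : ℝ => Complex.exp (s * (-Real.log x : ℝ))) (by fun_prop)

lemma integrable_cexp_mul_negLogSum {k : ℕ} {s : ℂ} (hs : s.re < k + 1) :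
    Integrable (fun x => Complex.exp (s * (negLogSum x k : ℝ))) expSeq :=
  (identDistrib_cexp_mul_negLogSum k s).integrable_iff.2
    (integrable_cexp_mul_neg_log_gammaMeasure (by positivity) one_pos hs)

lemma integral_cexp_mul_negLogSum {k : ℕ} {s : ℂ} (hs : s.re < k + 1) :
    ∫ x, Complex.exp (s * (negLogSum x k : ℝ)) ∂expSeq =
      Complex.Gamma (k + 1 - s) / Complex.Gamma (k + 1) := by
  rw [(identDistrib_cexp_mul_negLogSum k s).integral_eq,
    integral_cexp_mul_neg_log_gammaMeasure (by positivity) one_pos hs]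
  simp

lemma indepFun_harmonicTail_logIncr_negLogSum (n k : ℕ) :
    IndepFun (fun x => harmonicTail n (logIncr x) k) (fun x => negLogSum x n) expSeq := by
  have h := (indepFun_logIncr_sum n).comp
    (φ := fun y => extendByZero (Matrix.toLin' (tailMatrix n) y) k) (ψ := fun t => -Real.log t)
    ((measurable_pi_apply k).comp (measurable_extendByZero.comp measurable_toLin'_tailMatrix))
    (by fun_prop)
  simp only [harmonicTail_eq_extendByZero]
  exact h

lemma identDistrib_cexp_mul_harmonicTail_logIncr (n k : ℕ) (s : ℂ) :
    IdentDistrib (fun x => Complex.exp (s * (harmonicTail n (logIncr x) k : ℝ)))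
      (fun x => Complex.exp (s * (harmonicTail n x k : ℝ))) expSeq expSeq :=
  (hasLaw_logIncr.identDistrib HasLaw.id).comp
    (u := fun x => Complex.exp (s * (harmonicTail n x k : ℝ)))
    (by fun_prop)

lemma indepFun_cexp_mul_harmonicTail_logIncr_negLogSum (n k : ℕ) (s : ℂ) :
    IndepFun (fun x => Complex.exp (s * (harmonicTail n (logIncr x) k : ℝ)))
      (fun x => Complex.exp (s * (negLogSum x n : ℝ))) expSeq :=
  (indepFun_harmonicTail_logIncr_negLogSum n k).comp (φ := fun y : ℝ => Complex.exp (s * y))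
    (ψ := fun y : ℝ => Complex.exp (s * y)) (by fun_prop) (by fun_prop)

lemma cexp_mul_harmonicTail_logIncr_mul {n k : ℕ} (hk : k ≤ n) (s : ℂ) (x : ℕ → ℝ) :
    Complex.exp (s * (harmonicTail n (logIncr x) k : ℝ)) *
      Complex.exp (s * (negLogSum x n : ℝ)) = Complex.exp (s * (negLogSum x k : ℝ)) := by
  rw [← Complex.exp_add, ← mul_add, ← Complex.ofReal_add, harmonicTail_logIncr hk, sub_add_cancel]

lemma aestronglyMeasurable_cexp_mul_negLogSum (k : ℕ) (s : ℂ) :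
    AEStronglyMeasurable (fun x => Complex.exp (s * (negLogSum x k : ℝ))) expSeq :=
  (show Measurable _ by fun_prop).aestronglyMeasurable

lemma integrable_cexp_mul_harmonicTail {n k : ℕ} (hk : k ≤ n) {s : ℂ} (hs : s.re < k + 1) :
    Integrable (fun x => Complex.exp (s * (harmonicTail n x k : ℝ))) expSeq := by
  have hid := identDistrib_cexp_mul_harmonicTail_logIncr n k s
  have hne : ¬(fun x => Complex.exp (s * (negLogSum x n : ℝ))) =ᵐ[expSeq] 0 := fun h =>
    have ⟨_, hx⟩ := h.exists
    Complex.exp_ne_zero _ hx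
  refine hid.integrable_iff.1 <|
    (indepFun_cexp_mul_harmonicTail_logIncr_negLogSum n k s).integrable_left_of_integrable_op
      (· * ·) 1 one_ne_zero (fun x y => by simp) ?_ hid.aemeasurable_fst.aestronglyMeasurable
      (aestronglyMeasurable_cexp_mul_negLogSum n s) hne
  simpa only [cexp_mul_harmonicTail_logIncr_mul hk] using integrable_cexp_mul_negLogSum hs

lemma integral_cexp_mul_harmonicTail {n k : ℕ} (hk : k ≤ n) {s : ℂ} (hs : s.re < k + 1) :
    ∫ x, Complex.exp (s * (harmonicTail n x k : ℝ)) ∂expSeq =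
      Complex.Gamma (n + 1) * Complex.Gamma (k + 1 - s) /
        (Complex.Gamma (k + 1) * Complex.Gamma (n + 1 - s)) := by
  have hsn : s.re < n + 1 := hs.trans_le (by gcongr)
  have hid := identDistrib_cexp_mul_harmonicTail_logIncr n k s
  have hmul :=
    (indepFun_cexp_mul_harmonicTail_logIncr_negLogSum n k s).integral_fun_mul_eq_mul_integral
      hid.aemeasurable_fst.aestronglyMeasurable (aestronglyMeasurable_cexp_mul_negLogSum n s)
  simp only [cexp_mul_harmonicTail_logIncr_mul hk, hid.integral_eq,
    integral_cexp_mul_negLogSum hs, integral_cexp_mul_negLogSum hsn] at hmul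
  have hn : Complex.Gamma (n + 1) ≠ 0 := Complex.Gamma_ne_zero_of_re_pos (by
    simp only [Complex.add_re, Complex.natCast_re, Complex.one_re]; positivity)
  have hns : Complex.Gamma (n + 1 - s) ≠ 0 := Complex.Gamma_ne_zero_of_re_pos (by simpa using hsn)
  rw [mul_comm (Complex.Gamma (n + 1)), ← div_mul_div_comm, hmul, mul_assoc,
    div_mul_div_cancel₀ hn, div_self hns, mul_one]

end LaplaceTransforms

section IndependentSeries

variable {Ω : Type*} [MeasurableSpace Ω] {P : Measure Ω}

lemma eLpNorm_two_eq_sqrt_variance {X : Ω → ℝ} (hX : MemLp X 2 P) (hmean : P[X] = 0) :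
    eLpNorm X 2 P = ENNReal.ofReal (√Var[X; P]) := by
  rw [hX.eLpNorm_eq_integral_rpow_norm two_ne_zero ENNReal.ofNat_ne_top,
    variance_of_integral_eq_zero hX.aemeasurable hmean, Real.sqrt_eq_rpow]
  simp

variable [IsProbabilityMeasure P] {Y : ℕ → Ω → ℝ}

lemma eLpNorm_two_sum (hY : ∀ i, MemLp (Y i) 2 P) (hmean : ∀ i, P[Y i] = 0)
    (hindep : Pairwise fun i j => IndepFun (Y i) (Y j) P) (s : Finset ℕ) :
    eLpNorm (fun ω => ∑ i ∈ s, Y i ω) 2 P = ENNReal.ofReal (√(∑ i ∈ s, Var[Y i; P])) := by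
  rw [← IndepFun.variance_sum (fun i _ => hY i) fun i _ j _ hij => hindep hij, Finset.sum_fn,
    eLpNorm_two_eq_sqrt_variance (memLp_finsetSum s fun i _ => hY i)]
  rw [integral_finsetSum s fun i _ => (hY i).integrable one_le_two]
  exact Finset.sum_eq_zero fun i _ => hmean i

theorem tendsto_eLpNorm_two_sum_sub (hY : ∀ i, MemLp (Y i) 2 P) (hmean : ∀ i, P[Y i] = 0)
    (hindep : Pairwise fun i j => IndepFun (Y i) (Y j) P)
    (hvar : Summable fun i => Var[Y i; P]) {k : ℕ} {S : Ω → ℝ}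
    (hS : ∀ᵐ ω ∂P, Tendsto (fun N => ∑ i ∈ Finset.Ico k N, Y i ω) atTop (𝓝 (S ω))) :
    Tendsto (fun N => eLpNorm (fun ω => ∑ i ∈ Finset.Ico k N, Y i ω - S ω) 2 P) atTop (𝓝 0) := by
  have hzero : Tendsto (fun N => ENNReal.ofReal (√(∑' i, Var[Y (i + N); P]))) atTop (𝓝 0) := by
    simpa using ENNReal.tendsto_ofReal (tendsto_sum_nat_add fun i => Var[Y i; P]).sqrt
  refine tendsto_of_tendsto_of_tendsto_of_le_of_le' tendsto_const_nhds hzero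
    (.of_forall fun _ => zero_le) ?_
  filter_upwards [eventually_ge_atTop k] with N hN
  have hdiff (M : ℕ) (hM : N ≤ M) : eLpNorm (fun ω => ∑ i ∈ Finset.Ico k N, Y i ω -
      ∑ i ∈ Finset.Ico k M, Y i ω) 2 P ≤ ENNReal.ofReal (√(∑' i, Var[Y (i + N); P])) := by
    have htail (ω : Ω) : ∑ i ∈ Finset.Ico k N, Y i ω - ∑ i ∈ Finset.Ico k M, Y i ω =
        -∑ i ∈ Finset.Ico N M, Y i ω := by
      rw [← Finset.sum_Ico_consecutive _ hN hM]
      ring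
    simp only [htail]
    rw [← Pi.neg_def, eLpNorm_neg, eLpNorm_two_sum hY hmean hindep, Finset.sum_Ico_eq_sum_range]
    simp only [add_comm N]
    gcongr
    exact ((summable_nat_add_iff N).2 hvar).sum_le_tsum _ fun i _ => variance_nonneg _ _
  have hmeas (M : ℕ) : AEStronglyMeasurable (fun ω => ∑ i ∈ Finset.Ico k M, Y i ω) P :=
    (memLp_finsetSum _ fun i _ => hY i).aestronglyMeasurable
  refine (Lp.eLpNorm_lim_le_liminf_eLpNorm (fun M => (hmeas N).sub (hmeas M)) _ ?_).trans ?_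
  · filter_upwards [hS] with ω hω using tendsto_const_nhds.sub hω
  · refine liminf_le_of_frequently_le' (Eventually.frequently ?_)
    filter_upwards [eventually_ge_atTop N] with M hM using hdiff M hM

end IndependentSeries

section Means

lemma memLp_eval_expSeq (i : ℕ) : MemLp (fun x : ℕ → ℝ => x i) 2 expSeq :=
  ((hasLaw_eval_expSeq i).identDistrib HasLaw.id).memLp_iff.2 (memLp_id_expMeasure one_pos)

lemma integral_eval_expSeq (i : ℕ) : ∫ x, x i ∂expSeq = 1 := by
  rw [(hasLaw_eval_expSeq i).integral_eq, integral_id_expMeasure one_pos, div_one]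

lemma variance_eval_expSeq (i : ℕ) : Var[fun x => x i; expSeq] = 1 := by
  rw [(hasLaw_eval_expSeq i).variance_eq, variance_id_expMeasure one_pos, one_pow, div_one]

lemma sum_Ico_one_div {n k : ℕ} (hk : k ≤ n) :
    ∑ j ∈ Finset.Ico k n, 1 / ((j : ℝ) + 1) = (harmonic n : ℝ) - (harmonic k : ℝ) := by
  rw [Finset.sum_Ico_eq_sub _ hk]
  simp [harmonic]

lemma integrable_harmonicTail (n k : ℕ) : Integrable (fun x => harmonicTail n x k) expSeq :=
  integrable_finsetSum _ fun i _ => ((memLp_eval_expSeq i).integrable one_le_two).div_const _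

lemma integral_harmonicTail {n k : ℕ} (hk : k ≤ n) :
    ∫ x, harmonicTail n x k ∂expSeq = (harmonic n : ℝ) - (harmonic k : ℝ) := by
  simp only [harmonicTail]
  rw [integral_finsetSum _ fun i _ => ((memLp_eval_expSeq i).integrable one_le_two).div_const _,
    ← sum_Ico_one_div hk]
  simp only [integral_div, integral_eval_expSeq]

end Means

section AlmostSureLimits

lemma ae_tendsto_log_sum_sub_log :
    ∀ᵐ x ∂expSeq, Tendsto (fun n : ℕ =>
      Real.log (∑ i ∈ Finset.range (n + 1), x i) - Real.log n) atTop (𝓝 0) := by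
  have hslln := strong_law_ae_real (fun (i : ℕ) (x : ℕ → ℝ) => x i)
    ((memLp_eval_expSeq 0).integrable one_le_two)
    (fun i j hij => iIndepFun_eval_expSeq.indepFun hij)
    (fun i => (hasLaw_eval_expSeq i).identDistrib (hasLaw_eval_expSeq 0))
  rw [integral_eval_expSeq] at hslln
  filter_upwards [hslln, ae_pos_expSeq] with x hx hpos
  have hlog := ((hx.comp (tendsto_add_atTop_nat 1)).log one_ne_zero).add
    Real.tendsto_log_nat_add_one_sub_log
  rw [Real.log_one, add_zero] at hlog
  refine hlog.congr fun n => ?_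
  have hsum : 0 < ∑ i ∈ Finset.range (n + 1), x i := Finset.sum_pos (fun i _ => hpos i) (by simp)
  simp only [Function.comp_apply]
  rw [Real.log_div hsum.ne' (by positivity)]
  push_cast
  ring

lemma ae_tendsto_harmonicTail_logIncr_sub_log :
    ∀ᵐ x ∂expSeq, ∀ k, Tendsto (fun n : ℕ => harmonicTail n (logIncr x) k - Real.log n) atTop
      (𝓝 (negLogSum x k)) := by
  filter_upwards [ae_tendsto_log_sum_sub_log] with x hx k
  have h := hx.const_add (negLogSum x k)
  rw [add_zero] at h
  refine h.congr' ?_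
  filter_upwards [eventually_ge_atTop k] with n hn
  rw [harmonicTail_logIncr hn, negLogSum, negLogSum]
  ring

lemma harmonicTail_sub_one {N k : ℕ} (hk : k ≤ N) (x : ℕ → ℝ) :
    harmonicTail N (x - 1) k = harmonicTail N x k - ((harmonic N : ℝ) - (harmonic k : ℝ)) := by
  rw [← sum_Ico_one_div hk, harmonicTail, harmonicTail, ← Finset.sum_sub_distrib]
  exact Finset.sum_congr rfl fun i _ => sub_div _ _ _

lemma ae_tendsto_harmonicTail_logIncr_sub_one :
    ∀ᵐ x ∂expSeq, ∀ k, Tendsto (fun N => harmonicTail N (logIncr x - 1) k) atTop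
      (𝓝 (negLogSum x k - Real.eulerMascheroniConstant + (harmonic k : ℝ))) := by
  filter_upwards [ae_tendsto_harmonicTail_logIncr_sub_log] with x hx k
  refine (((hx k).sub Real.tendsto_harmonic_sub_log).add_const (harmonic k : ℝ)).congr' ?_
  filter_upwards [eventually_ge_atTop k] with N hN
  rw [harmonicTail_sub_one hN]
  ring

/-- The sums of the series `∑ j ≥ k, (x j - 1) / (j + 1)`, as a function of `k`. The value is a
default one where the series diverges. -/
noncomputable def centredSeries (x : ℕ → ℝ) (k : ℕ) : ℝ :=
  limUnder atTop fun N => harmonicTail N (x - 1) k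

@[fun_prop]
lemma measurable_centredSeries : Measurable centredSeries :=
  measurable_pi_lambda _ fun k => (StronglyMeasurable.limUnder fun N =>
    (show Measurable fun x => harmonicTail N (x - 1) k by fun_prop).stronglyMeasurable).measurable

lemma ae_tendsto_harmonicTail_sub_one :
    ∀ᵐ x ∂expSeq, ∀ k, Tendsto (fun N => harmonicTail N (x - 1) k) atTop
      (𝓝 (centredSeries x k)) := by
  refine ae_all_iff.2 fun k => ?_
  have hconv : ∀ᵐ x ∂expSeq, ∃ l, Tendsto (fun N => harmonicTail N (x - 1) k) atTop (𝓝 l) := by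
    rw [← hasLaw_logIncr.ae_iff (measurableSet_setOfPred.1
      (measurableSet_exists_tendsto fun N => by fun_prop))]
    filter_upwards [ae_tendsto_harmonicTail_logIncr_sub_one] with x hx using ⟨_, hx k⟩
  filter_upwards [hconv] with x hx using tendsto_nhds_limUnder hx

theorem identDistrib_centredSeries :
    IdentDistrib centredSeries
      (fun x k => negLogSum x k - Real.eulerMascheroniConstant + (harmonic k : ℝ))
      expSeq expSeq := by
  refine ((hasLaw_logIncr.identDistrib HasLaw.id).comp measurable_centredSeries).symm.trans
    (.of_ae_eq (by fun_prop) ?_)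
  filter_upwards [ae_tendsto_harmonicTail_logIncr_sub_one] with x hx
  exact funext fun k => (hx k).limUnder_eq

end AlmostSureLimits

section CentredSeries

lemma memLp_eval_sub_one_div (i : ℕ) :
    MemLp (fun x : ℕ → ℝ => (x i - 1) / ((i : ℝ) + 1)) 2 expSeq := by
  simpa [div_eq_mul_inv] using
    ((memLp_eval_expSeq i).sub (memLp_const 1)).mul_const ((i : ℝ) + 1)⁻¹

lemma memLp_harmonicTail_sub_one (N k : ℕ) :
    MemLp (fun x => harmonicTail N (x - 1) k) 2 expSeq :=
  memLp_finsetSum _ fun i _ => memLp_eval_sub_one_div i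

lemma tendsto_eLpNorm_harmonicTail_sub_centredSeries (k : ℕ) :
    Tendsto (fun N => eLpNorm (fun x => harmonicTail N (x - 1) k - centredSeries x k) 2 expSeq)
      atTop (𝓝 0) := by
  refine tendsto_eLpNorm_two_sum_sub memLp_eval_sub_one_div (fun i => ?_) (fun i j hij => ?_) ?_
    (ae_all_iff.1 ae_tendsto_harmonicTail_sub_one k)
  · have hint := (memLp_eval_expSeq i).integrable one_le_two
    simp [integral_div, integral_sub hint (integrable_const _), integral_eval_expSeq]
  · exact (iIndepFun_eval_expSeq.indepFun hij).comp (φ := fun t : ℝ => (t - 1) / ((i : ℝ) + 1))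
      (ψ := fun t : ℝ => (t - 1) / ((j : ℝ) + 1)) (by fun_prop) (by fun_prop)
  · have hvar (i : ℕ) : Var[fun x => (x i - 1) / ((i : ℝ) + 1); expSeq] = 1 / (i + 1 : ℕ) ^ 2 := by
      simp only [div_eq_mul_inv]
      rw [variance_mul_const, variance_sub_const (memLp_eval_expSeq i).aestronglyMeasurable,
        variance_eval_expSeq]
      simp
    simp only [hvar]
    exact (summable_nat_add_iff 1).2 (Real.summable_one_div_nat_pow.2 one_lt_two)

lemma memLp_centredSeries (k : ℕ) : MemLp (fun x => centredSeries x k) 2 expSeq :=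
  Lp.memLp_of_cauchy_tendsto one_le_two (fun N => memLp_harmonicTail_sub_one N k) _
    (by fun_prop) (tendsto_eLpNorm_harmonicTail_sub_centredSeries k)

lemma integral_centredSeries (k : ℕ) : ∫ x, centredSeries x k ∂expSeq = 0 := by
  have hL1 : Tendsto (fun N => eLpNorm ((fun x => harmonicTail N (x - 1) k) -
      fun x => centredSeries x k) 1 expSeq) atTop (𝓝 0) :=
    tendsto_of_tendsto_of_tendsto_of_le_of_le tendsto_const_nhds
      (tendsto_eLpNorm_harmonicTail_sub_centredSeries k) (fun _ => zero_le) fun N =>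
        eLpNorm_le_eLpNorm_of_exponent_le one_le_two
          ((memLp_harmonicTail_sub_one N k).sub (memLp_centredSeries k)).aestronglyMeasurable
  refine tendsto_nhds_unique (tendsto_integral_of_L1' _
    (memLp_centredSeries k).aestronglyMeasurable
    (.of_forall fun N => (memLp_harmonicTail_sub_one N k).integrable one_le_two) hL1)
    (tendsto_const_nhds.congr' ?_)
  filter_upwards [eventually_ge_atTop k] with N hN
  simp only [harmonicTail_sub_one hN]
  rw [integral_sub (integrable_harmonicTail N k) (integrable_const _), integral_harmonicTail hN]
  simp

lemma identDistrib_negLogSum_centredSeries (k : ℕ) :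
    IdentDistrib (fun x => negLogSum x k)
      (fun x => centredSeries x k + (Real.eulerMascheroniConstant - (harmonic k : ℝ)))
      expSeq expSeq := by
  have h := (identDistrib_centredSeries.comp (measurable_pi_apply k)).symm.comp
    (measurable_add_const (Real.eulerMascheroniConstant - (harmonic k : ℝ)))
  refine (IdentDistrib.of_ae_eq (by fun_prop) (.of_forall fun x => ?_)).trans h
  simp

lemma integrable_negLogSum (k : ℕ) : Integrable (fun x => negLogSum x k) expSeq :=
  (identDistrib_negLogSum_centredSeries k).integrable_iff.2
    (((memLp_centredSeries k).integrable one_le_two).add (integrable_const _))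

lemma integral_negLogSum (k : ℕ) :
    ∫ x, negLogSum x k ∂expSeq = Real.eulerMascheroniConstant - (harmonic k : ℝ) := by
  rw [(identDistrib_negLogSum_centredSeries k).integral_eq,
    integral_add ((memLp_centredSeries k).integrable one_le_two) (integrable_const _),
    integral_centredSeries]
  simp

end CentredSeries

section MarkovChain

variable {Ω Ω' S F : Type*} [MeasurableSpace Ω] [MeasurableSpace Ω'] [MeasurableSpace S]
  [MeasurableSpace F] {P : Measure Ω} {P' : Measure Ω'} {X : ℕ → Ω → S} {κ : Kernel S S}

lemma map_compProd_of_apply_eq_map {E G : Type*} [MeasurableSpace E] [MeasurableSpace G]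
    {μ : Measure E} [SFinite μ] {ν : Measure F} [SFinite ν] {f : E × F → G} (hf : Measurable f)
    {κ : Kernel E G} [IsSFiniteKernel κ] (hκ : ∀ x, κ x = ν.map fun u => f (x, u)) :
    (μ.prod ν).map (fun p => (p.1, f p)) = μ ⊗ₘ κ := by
  have hg : Measurable fun p : E × F => (p.1, f p) := measurable_fst.prodMk hf
  ext s hs
  rw [Measure.map_apply hg hs, Measure.prod_apply (hg hs), Measure.compProd_apply hs]
  refine lintegral_congr fun x => ?_
  rw [hκ, Measure.map_apply (by fun_prop) (measurable_prodMk_left hs)]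
  rfl

theorem IsHomogeneousMarkovChain.of_recursion [IsMarkovKernel κ] {ν : Measure F}
    [IsProbabilityMeasure ν] {U : ℕ → Ω → F} (hX : ∀ k, AEMeasurable (X k) P)
    (hU : ∀ k, HasLaw (U k) ν P)
    (hind : ∀ k, IndepFun (fun ω (i : Fin (k + 1)) => X i ω) (U k) P) {f : S × F → S}
    (hf : Measurable f) (hκ : ∀ x, κ x = ν.map fun u => f (x, u))
    (hrec : ∀ k, X (k + 1) =ᵐ[P] fun ω => f (X k ω, U k ω)) :
    IsHomogeneousMarkovChain X κ P := by
  have := (hU 0).isProbabilityMeasure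
  refine ⟨inferInstance, fun k => ?_⟩
  have hhist : HasLaw (fun ω (i : Fin (k + 1)) => X i ω)
      (P.map fun ω (i : Fin (k + 1)) => X i ω) P :=
    ⟨aemeasurable_pi_lambda _ fun i => hX i, rfl⟩
  have hstep : Measurable fun p : (Fin (k + 1) → S) × F => f (p.1 (Fin.last k), p.2) := by
    fun_prop
  have hmap := map_compProd_of_apply_eq_map (μ := P.map fun ω (i : Fin (k + 1)) => X i ω)
    (ν := ν) (κ := κ.comap (fun h : Fin (k + 1) → S => h (Fin.last k)) (measurable_pi_apply _))
    hstep fun h => by rw [Kernel.comap_apply, hκ]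
  refine (HasLaw.fun_comp ⟨(measurable_fst.prodMk hstep).aemeasurable, hmap⟩
    ((hind k).hasLaw_prod hhist (hU k))).congr ?_
  filter_upwards [hrec k] with ω hω
  simp [hω]

lemma IsHomogeneousMarkovChain.of_identDistrib {Y : ℕ → Ω' → S}
    (h : IsHomogeneousMarkovChain X κ P)
    (hXY : IdentDistrib (fun ω k => X k ω) (fun ω k => Y k ω) P P') :
    IsHomogeneousMarkovChain Y κ P' := by
  refine ⟨h.1, fun k => ?_⟩
  have hpair := hXY.comp (u := fun y : ℕ → S => (fun i : Fin (k + 1) => y i, y (k + 1)))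
    (by fun_prop)
  have hhist := hXY.comp (u := fun (y : ℕ → S) (i : Fin (k + 1)) => y i) (by fun_prop)
  simp only [Function.comp_def] at hpair hhist
  exact ⟨hpair.aemeasurable_snd, by rw [← hpair.map_eq, ← hhist.map_eq, (h.2 k).map_eq]⟩

lemma IsHomogeneousMarkovChain.hasCondDistrib [SFinite P]
    (h : IsHomogeneousMarkovChain X κ P) (k : ℕ) : HasCondDistrib (X (k + 1)) (X k) κ P := by
  have := h.1
  exact (h.2 k).comp_right

end MarkovChain

section Gumbel

lemma expMeasure_Ici {r c : ℝ} (hr : 0 < r) (hc : 0 ≤ c) :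
    expMeasure r (Set.Ici c) = ENNReal.ofReal (Real.exp (-(r * c))) := by
  have := isProbabilityMeasure_expMeasure hr
  rw [← measure_congr Ioi_ae_eq_Ici, ← Set.compl_Iic, prob_compl_eq_one_sub measurableSet_Iic,
    ← ofReal_cdf, cdf_expMeasure_eq hr, if_pos hc, ← ENNReal.ofReal_one,
    ← ENNReal.ofReal_sub _ (by simpa using mul_nonneg hr.le hc), sub_sub_cancel]

lemma map_neg_log_add_expMeasure_Iic {b x : ℝ} (hb : 0 ≤ b) (hx : b ≤ Real.exp (-x)) :
    (expMeasure 1).map (fun t => -Real.log (b + t)) (Set.Iic x) =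
      ENNReal.ofReal (Real.exp (b - Real.exp (-x))) := by
  have hset : (fun t => -Real.log (b + t)) ⁻¹' Set.Iic x =ᵐ[expMeasure 1]
      Set.Ici (Real.exp (-x) - b) := by
    refine eventuallyEq_set.2 ?_
    filter_upwards [ae_pos_gammaMeasure 1 1] with t ht
    have hpos : 0 < b + t := by linarith
    rw [Set.mem_preimage, Set.mem_Iic, neg_le, Real.le_log_iff_exp_le hpos, Set.mem_Ici,
      sub_le_iff_le_add']
  rw [Measure.map_apply (by fun_prop) measurableSet_Iic, measure_congr hset,
    expMeasure_Ici one_pos (sub_nonneg.2 hx), one_mul, neg_sub]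

/-- The standard Gumbel distribution, as the law of `-log T` for `T` of law `Exp(1)`. -/
noncomputable def gumbelMeasure : Measure ℝ := (expMeasure 1).map fun t => -Real.log t

instance isProbabilityMeasure_gumbelMeasure : IsProbabilityMeasure gumbelMeasure :=
  Measure.isProbabilityMeasure_map (by fun_prop)

lemma gumbelMeasure_Iic (x : ℝ) :
    gumbelMeasure (Set.Iic x) = ENNReal.ofReal (Real.exp (-Real.exp (-x))) := by
  simpa [gumbelMeasure] using map_neg_log_add_expMeasure_Iic le_rfl (Real.exp_pos (-x)).le

/-- The law of `-log (exp (-y) + T)` for `T` of law `Exp(1)`, as a kernel in `y`: the transition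
kernel of the sequence `-log T₁, -log (T₁ + T₂), …`. -/
noncomputable def logShiftKernel : Kernel ℝ ℝ :=
  (Kernel.id ×ₖ Kernel.const ℝ (expMeasure 1)).map
    fun p : ℝ × ℝ => -Real.log (Real.exp (-p.1) + p.2)

instance isMarkovKernel_logShiftKernel : IsMarkovKernel logShiftKernel :=
  Kernel.IsMarkovKernel.map _ (by fun_prop)

lemma logShiftKernel_apply (y : ℝ) :
    logShiftKernel y = (expMeasure 1).map fun t => -Real.log (Real.exp (-y) + t) := by
  rw [logShiftKernel, Kernel.map_apply _ (by fun_prop), Kernel.prod_apply, Kernel.id_apply,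
    Kernel.const_apply, Measure.dirac_prod, Measure.map_map (by fun_prop) measurable_prodMk_left]
  rfl

lemma logShiftKernel_Iic {x y : ℝ} (hxy : x ≤ y) :
    logShiftKernel y (Set.Iic x) = ENNReal.ofReal (Real.exp (Real.exp (-y) - Real.exp (-x))) := by
  rw [logShiftKernel_apply, map_neg_log_add_expMeasure_Iic (Real.exp_pos _).le
    (Real.exp_le_exp.2 (neg_le_neg hxy))]

theorem logShiftKernel_eq_cond_gumbelMeasure (y : ℝ) :
    logShiftKernel y = ProbabilityTheory.cond gumbelMeasure (Set.Iic y) := by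
  have hpos : gumbelMeasure (Set.Iic y) ≠ 0 := by simp [gumbelMeasure_Iic, Real.exp_pos]
  have := cond_isProbabilityMeasure hpos
  refine Measure.ext_of_Iic _ _ fun x => ?_
  rw [cond_apply measurableSet_Iic, Set.Iic_inter_Iic]
  rcases le_total x y with hxy | hyx
  · rw [min_eq_right hxy, logShiftKernel_Iic hxy, gumbelMeasure_Iic, gumbelMeasure_Iic,
      ← ENNReal.ofReal_inv_of_pos (Real.exp_pos _), ← ENNReal.ofReal_mul (by positivity),
      ← Real.exp_neg, ← Real.exp_add, neg_neg, ← sub_eq_add_neg]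
  · rw [min_eq_left hyx, ENNReal.inv_mul_cancel hpos (measure_ne_top _ _)]
    have hy : logShiftKernel y (Set.Iic y) = 1 := by simp [logShiftKernel_Iic le_rfl]
    exact le_antisymm prob_le_one (hy ▸ measure_mono (Set.Iic_subset_Iic.2 hyx))

lemma exp_neg_negLogSum {x : ℕ → ℝ} (hx : ∀ i, 0 < x i) (k : ℕ) :
    Real.exp (-negLogSum x k) = ∑ i ∈ Finset.range (k + 1), x i := by
  rw [negLogSum, neg_neg, Real.exp_log (Finset.sum_pos (fun i _ => hx i) (by simp))]

theorem isHomogeneousMarkovChain_negLogSum :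
    IsHomogeneousMarkovChain (fun k x => negLogSum x k) logShiftKernel expSeq := by
  refine .of_recursion (U := fun k x => x (k + 1)) (fun k => by fun_prop)
    (fun k => hasLaw_eval_expSeq (k + 1)) (fun k => ?_)
    (f := fun p => -Real.log (Real.exp (-p.1) + p.2)) (by fun_prop) logShiftKernel_apply
    fun k => ?_
  · refine indepFun_eval_infinitePi_of_dependsOn _ (s := Finset.range (k + 1)) (by fun_prop)
      (fun x y hxy => funext fun i => ?_) (by simp)
    refine congrArg (fun s => -Real.log s) (Finset.sum_congr rfl fun j hj => hxy j ?_)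
    simp only [Finset.coe_range, Set.mem_Iio, Finset.mem_range] at hj ⊢
    omega
  · filter_upwards [ae_pos_expSeq] with x hx
    rw [exp_neg_negLogSum hx, ← Finset.sum_range_succ, negLogSum]

end Gumbel

section ConvergenceInDistribution

lemma tendstoInDistribution_congr_identDistrib {ι E Ω' Ω'' : Type*} {Ω₁ Ω₂ : ι → Type*}
    [∀ i, MeasurableSpace (Ω₁ i)] [∀ i, MeasurableSpace (Ω₂ i)] [MeasurableSpace Ω']
    [MeasurableSpace Ω''] [MeasurableSpace E] [TopologicalSpace E] [OpensMeasurableSpace E]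
    {μ : ∀ i, Measure (Ω₁ i)} [∀ i, IsProbabilityMeasure (μ i)]
    {ν : ∀ i, Measure (Ω₂ i)} [∀ i, IsProbabilityMeasure (ν i)]
    {μ' : Measure Ω'} [IsProbabilityMeasure μ'] {ν' : Measure Ω''} [IsProbabilityMeasure ν']
    {X : ∀ i, Ω₁ i → E} {Y : ∀ i, Ω₂ i → E} {Z : Ω' → E} {W : Ω'' → E} {l : Filter ι}
    (h : TendstoInDistribution X l Z μ μ') (hXY : ∀ i, IdentDistrib (X i) (Y i) (μ i) (ν i))
    (hZW : IdentDistrib Z W μ' ν') : TendstoInDistribution Y l W ν ν' where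
  forall_aemeasurable i := (hXY i).aemeasurable_snd
  aemeasurable_limit := hZW.aemeasurable_snd
  tendsto := by
    simpa only [(hXY _).map_eq, hZW.map_eq] using h.tendsto

/-- The law on `ℝ^ℕ` of the sequence `-log T₁, -log (T₁ + T₂), …` for independent `T₁, T₂, …` of
law `Exp(1)`, that is, of the points of a Poisson process of intensity `exp (-x) dx` in decreasing
order. -/
noncomputable def gumbelSeq : Measure (ℕ → ℝ) := expSeq.map negLogSum

instance isProbabilityMeasure_gumbelSeq : IsProbabilityMeasure gumbelSeq :=
  Measure.isProbabilityMeasure_map (by fun_prop)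

lemma hasLaw_negLogSum_gumbelSeq : HasLaw negLogSum gumbelSeq expSeq := ⟨by fun_prop, rfl⟩

lemma tendstoInDistribution_harmonicTail_logIncr_sub_log :
    TendstoInDistribution (fun (n : ℕ) x k => harmonicTail n (logIncr x) k - Real.log n) atTop
      negLogSum (fun _ => expSeq) expSeq := by
  refine tendstoInDistribution_of_ae_tendsto (fun n => by fun_prop) (by fun_prop) ?_
  filter_upwards [ae_tendsto_harmonicTail_logIncr_sub_log] with x hx
  exact tendsto_pi_nhds.2 hx

variable {Ω : Type*} [MeasurableSpace Ω] {P : Measure Ω} {X : Ω → ℕ → ℝ}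

lemma identDistrib_kthLargest (hX : HasLaw X expSeq P) (n : ℕ) :
    IdentDistrib (fun ω k => kthLargest n k (X ω)) (harmonicTail n) P expSeq :=
  ((hX.identDistrib HasLaw.id).comp (measurable_kthLargest n)).trans
    ⟨(measurable_kthLargest n).aemeasurable, (measurable_harmonicTail n).aemeasurable,
      map_kthLargest_expSeq n⟩

theorem tendstoInDistribution_kthLargest_sub_log [IsProbabilityMeasure P]
    (hX : HasLaw X expSeq P) :
    TendstoInDistribution (fun (n : ℕ) ω k => kthLargest n k (X ω) - Real.log n) atTop
      (fun w => w) (fun _ => P) gumbelSeq := by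
  refine tendstoInDistribution_congr_identDistrib
    tendstoInDistribution_harmonicTail_logIncr_sub_log (fun n => ?_)
    (hasLaw_negLogSum_gumbelSeq.identDistrib HasLaw.id)
  have hid := ((hasLaw_logIncr.identDistrib HasLaw.id).comp (measurable_harmonicTail n)).trans
    (identDistrib_kthLargest hX n).symm
  exact hid.comp (u := fun (y : ℕ → ℝ) k => y k - Real.log n) (by fun_prop)

end ConvergenceInDistribution

section ExponentialSample

variable {Ω : Type*} [MeasurableSpace Ω] {P : Measure Ω} {X : Ω → ℕ → ℝ}

lemma identDistrib_cexp_mul_kthLargest (hX : HasLaw X expSeq P) (n k : ℕ) (s : ℂ) :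
    IdentDistrib (fun ω => Complex.exp (s * (kthLargest n k (X ω) : ℝ)))
      (fun x => Complex.exp (s * (harmonicTail n x k : ℝ))) P expSeq :=
  (identDistrib_kthLargest hX n).comp
    (u := fun y : ℕ → ℝ => Complex.exp (s * (y k : ℝ))) (by fun_prop)

theorem integrable_cexp_mul_kthLargest (hX : HasLaw X expSeq P) {n k : ℕ} (hk : k ≤ n) {s : ℂ}
    (hs : s.re < k + 1) :
    Integrable (fun ω => Complex.exp (s * (kthLargest n k (X ω) : ℝ))) P :=
  (identDistrib_cexp_mul_kthLargest hX n k s).integrable_iff.2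
    (integrable_cexp_mul_harmonicTail hk hs)

theorem integral_cexp_mul_kthLargest (hX : HasLaw X expSeq P) {n k : ℕ} (hk : k ≤ n) {s : ℂ}
    (hs : s.re < k + 1) :
    ∫ ω, Complex.exp (s * (kthLargest n k (X ω) : ℝ)) ∂P =
      Complex.Gamma (n + 1) * Complex.Gamma (k + 1 - s) /
        (Complex.Gamma (k + 1) * Complex.Gamma (n + 1 - s)) :=
  (identDistrib_cexp_mul_kthLargest hX n k s).integral_eq.trans
    (integral_cexp_mul_harmonicTail hk hs)

theorem integrable_kthLargest (hX : HasLaw X expSeq P) (n k : ℕ) :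
    Integrable (fun ω => kthLargest n k (X ω)) P :=
  ((identDistrib_kthLargest hX n).comp (measurable_pi_apply k)).integrable_iff.2
    (integrable_harmonicTail n k)

theorem integral_kthLargest (hX : HasLaw X expSeq P) {n k : ℕ} (hk : k ≤ n) :
    ∫ ω, kthLargest n k (X ω) ∂P = (harmonic n : ℝ) - (harmonic k : ℝ) :=
  ((identDistrib_kthLargest hX n).comp (measurable_pi_apply k)).integral_eq.trans
    (integral_harmonicTail hk)

lemma tendsto_harmonic_sub_harmonic_sub_log (k : ℕ) :
    Tendsto (fun n : ℕ => (harmonic n : ℝ) - (harmonic k : ℝ) - Real.log n) atTop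
      (𝓝 (Real.eulerMascheroniConstant - (harmonic k : ℝ))) := by
  simpa only [sub_right_comm] using Real.tendsto_harmonic_sub_log.sub_const (harmonic k : ℝ)

theorem tendsto_integral_kthLargest_sub_log (hX : HasLaw X expSeq P) (k : ℕ) :
    Tendsto (fun n : ℕ => ∫ ω, (kthLargest n k (X ω) - Real.log n) ∂P) atTop
      (𝓝 (Real.eulerMascheroniConstant - (harmonic k : ℝ))) := by
  have := hX.isProbabilityMeasure
  refine (tendsto_harmonic_sub_harmonic_sub_log k).congr' ?_
  filter_upwards [eventually_ge_atTop k] with n hn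
  rw [integral_sub (integrable_kthLargest hX n k) (integrable_const _), integral_kthLargest hX hn]
  simp

theorem memLp_centredSeries_comp (hX : HasLaw X expSeq P) (k : ℕ) :
    MemLp (fun ω => centredSeries (X ω) k) 2 P :=
  ((hX.identDistrib HasLaw.id).comp
    (u := fun x => centredSeries x k) (by fun_prop)).memLp_iff.2 (memLp_centredSeries k)

theorem tendsto_eLpNorm_sum_sub_centredSeries_comp (hX : HasLaw X expSeq P) (k : ℕ) :
    Tendsto (fun N => eLpNorm (fun ω => (∑ i ∈ Finset.Ico k N, (X ω i - 1) / ((i : ℝ) + 1)) -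
      centredSeries (X ω) k) 2 P) atTop (𝓝 0) :=
  (tendsto_eLpNorm_harmonicTail_sub_centredSeries k).congr fun N =>
    (((hX.identDistrib HasLaw.id).comp
      (u := fun x => harmonicTail N (x - 1) k - centredSeries x k) (by fun_prop)).eLpNorm_eq 2).symm

theorem ae_tendsto_sum_centredSeries_comp (hX : HasLaw X expSeq P) (k : ℕ) :
    ∀ᵐ ω ∂P, Tendsto (fun N => ∑ i ∈ Finset.Ico k N, (X ω i - 1) / ((i : ℝ) + 1)) atTop
      (𝓝 (centredSeries (X ω) k)) := by
  have h := ae_tendsto_harmonicTail_sub_one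
  rw [← hX.map_eq] at h
  filter_upwards [ae_of_ae_map hX.aemeasurable h] with ω hω using hω k

end ExponentialSample

section GumbelSequence

variable {Ω Ω' : Type*} [MeasurableSpace Ω] [MeasurableSpace Ω'] {P : Measure Ω} {P' : Measure Ω'}
  {X : Ω → ℕ → ℝ} {W : Ω' → ℕ → ℝ}

lemma identDistrib_eval_gumbelSeq (hW : HasLaw W gumbelSeq P') (k : ℕ) :
    IdentDistrib (fun ω => W ω k) (fun x => negLogSum x k) P' expSeq :=
  (hW.identDistrib hasLaw_negLogSum_gumbelSeq).comp (measurable_pi_apply k)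

theorem hasLaw_eval_gumbelSeq (hW : HasLaw W gumbelSeq P') (k : ℕ) :
    HasLaw (fun ω => W ω k) ((gammaMeasure (k + 1) 1).map fun x => -Real.log x) P' :=
  (identDistrib_eval_gumbelSeq hW k).symm.hasLaw (hasLaw_negLogSum k)

theorem hasLaw_eval_zero_gumbelSeq (hW : HasLaw W gumbelSeq P') :
    HasLaw (fun ω => W ω 0) gumbelMeasure P' := by
  simpa [gumbelMeasure, expMeasure] using hasLaw_eval_gumbelSeq hW 0

lemma identDistrib_cexp_mul_eval_gumbelSeq (hW : HasLaw W gumbelSeq P') (k : ℕ) (s : ℂ) :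
    IdentDistrib (fun ω => Complex.exp (s * (W ω k : ℝ)))
      (fun x => Complex.exp (s * (negLogSum x k : ℝ))) P' expSeq :=
  (identDistrib_eval_gumbelSeq hW k).comp (u := fun t : ℝ => Complex.exp (s * t)) (by fun_prop)

theorem integrable_cexp_mul_eval_gumbelSeq (hW : HasLaw W gumbelSeq P') {k : ℕ} {s : ℂ}
    (hs : s.re < k + 1) : Integrable (fun ω => Complex.exp (s * (W ω k : ℝ))) P' :=
  (identDistrib_cexp_mul_eval_gumbelSeq hW k s).integrable_iff.2 (integrable_cexp_mul_negLogSum hs)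

theorem integral_cexp_mul_eval_gumbelSeq (hW : HasLaw W gumbelSeq P') {k : ℕ} {s : ℂ}
    (hs : s.re < k + 1) :
    ∫ ω, Complex.exp (s * (W ω k : ℝ)) ∂P' =
      Complex.Gamma (k + 1 - s) / Complex.Gamma (k + 1) :=
  (identDistrib_cexp_mul_eval_gumbelSeq hW k s).integral_eq.trans (integral_cexp_mul_negLogSum hs)

theorem integrable_eval_gumbelSeq (hW : HasLaw W gumbelSeq P') (k : ℕ) :
    Integrable (fun ω => W ω k) P' :=
  (identDistrib_eval_gumbelSeq hW k).integrable_iff.2 (integrable_negLogSum k)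

theorem integral_eval_gumbelSeq (hW : HasLaw W gumbelSeq P') (k : ℕ) :
    ∫ ω, W ω k ∂P' = Real.eulerMascheroniConstant - (harmonic k : ℝ) :=
  (identDistrib_eval_gumbelSeq hW k).integral_eq.trans (integral_negLogSum k)

theorem isHomogeneousMarkovChain_gumbelSeq (hW : HasLaw W gumbelSeq P') :
    IsHomogeneousMarkovChain (fun k ω => W ω k) logShiftKernel P' :=
  isHomogeneousMarkovChain_negLogSum.of_identDistrib
    (hasLaw_negLogSum_gumbelSeq.identDistrib hW)

theorem identDistrib_centredSeries_gumbelSeq (hX : HasLaw X expSeq P)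
    (hW : HasLaw W gumbelSeq P') :
    IdentDistrib (fun ω => centredSeries (X ω))
      (fun ω k => W ω k - Real.eulerMascheroniConstant + (harmonic k : ℝ)) P P' :=
  (((hX.identDistrib HasLaw.id).comp measurable_centredSeries).trans
    identDistrib_centredSeries).trans ((hasLaw_negLogSum_gumbelSeq.identDistrib hW).comp
      (u := fun (y : ℕ → ℝ) k => y k - Real.eulerMascheroniConstant + (harmonic k : ℝ))
      (by fun_prop))

lemma identDistrib_exp_neg_negLogSum :
    IdentDistrib (fun x k => Real.exp (-negLogSum x k))
      (fun x k => ∑ i ∈ Finset.range (k + 1), x i) expSeq expSeq := by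
  refine .of_ae_eq (by fun_prop) ?_
  filter_upwards [ae_pos_expSeq] with x hx using funext (exp_neg_negLogSum hx)

theorem identDistrib_exp_neg_gumbelSeq (hX : HasLaw X expSeq P) (hW : HasLaw W gumbelSeq P') :
    IdentDistrib (fun ω k => Real.exp (-W ω k))
      (fun ω k => ∑ i ∈ Finset.range (k + 1), X ω i) P' P :=
  (((hW.identDistrib hasLaw_negLogSum_gumbelSeq).comp
      (u := fun (y : ℕ → ℝ) k => Real.exp (-y k)) (by fun_prop)).trans
    identDistrib_exp_neg_negLogSum).trans ((hX.identDistrib HasLaw.id).comp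
      (u := fun (x : ℕ → ℝ) k => ∑ i ∈ Finset.range (k + 1), x i) (by fun_prop)).symm

end GumbelSequence

/-- Sequences are indexed from `0`: `T i`, `kthLargest n k` and `W k` below are
`T_{i+1}`, `M_n^{(m)}` and `W^{(m)}` with `m = k + 1`. -/
theorem mainTheorem4 {Ω : Type*} [MeasurableSpace Ω] (P : Measure Ω) [IsProbabilityMeasure P]
    (T : ℕ → Ω → ℝ) (hindep : iIndepFun T P) (hlaw : ∀ i, HasLaw (T i) (expMeasure 1) P) :
    -- the moment generating function and the mean of `M_n^{(m)}`, `1 ≤ m ≤ n`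
    (∀ n k : ℕ, k < n →
      (∀ s : ℂ, s.re < (k : ℝ) + 1 →
        Integrable (fun ω => Complex.exp (s * (kthLargest n k (fun i => T i ω) : ℝ))) P ∧
        ∫ ω, Complex.exp (s * (kthLargest n k (fun i => T i ω) : ℝ)) ∂P =
          Complex.Gamma ((n : ℂ) + 1) * Complex.Gamma ((k : ℂ) + 1 - s) /
            (Complex.Gamma ((k : ℂ) + 1) * Complex.Gamma ((n : ℂ) + 1 - s))) ∧
      Integrable (fun ω => kthLargest n k (fun i => T i ω)) P ∧
      ∫ ω, kthLargest n k (fun i => T i ω) ∂P = (harmonic n : ℝ) - (harmonic k : ℝ)) ∧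
    -- `(M_n^{(m)} - log n)_{m ≥ 1}` has a joint limit in distribution
    (∃ (Q : Measure (ℕ → ℝ)) (_ : IsProbabilityMeasure Q),
      TendstoInDistribution (fun (n : ℕ) ω => fun k : ℕ =>
        kthLargest n k (fun i => T i ω) - Real.log n) atTop (fun w => w) (fun _ => P) Q) ∧
    -- the series `∑_{j ≥ m} (T_j - 1) / j` converge in `L²` and almost surely, to `S k`, and
    ∃ S : ℕ → Ω → ℝ,
      (∀ k : ℕ, MemLp (S k) 2 P ∧
        Tendsto (fun N : ℕ => eLpNorm
          (fun ω => (∑ i ∈ Finset.Ico k N, (T i ω - 1) / ((i : ℝ) + 1)) - S k ω) 2 P)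
          atTop (𝓝 0) ∧
        ∀ᵐ ω ∂P, Tendsto (fun N : ℕ => ∑ i ∈ Finset.Ico k N, (T i ω - 1) / ((i : ℝ) + 1))
          atTop (𝓝 (S k ω))) ∧
      -- for every sequence `W` that is the joint limit in distribution:
      ∀ {Ω' : Type*} [MeasurableSpace Ω'] (P' : Measure Ω') [IsProbabilityMeasure P']
        (W : ℕ → Ω' → ℝ),
        TendstoInDistribution (fun (n : ℕ) ω => fun k : ℕ =>
          kthLargest n k (fun i => T i ω) - Real.log n) atTop (fun ω' => fun k => W k ω')
          (fun _ => P) P' →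
        (∀ k : ℕ,
          -- convergence in distribution for each single `m`
          TendstoInDistribution (fun (n : ℕ) ω =>
            kthLargest n k (fun i => T i ω) - Real.log n) atTop (W k) (fun _ => P) P' ∧
          -- `W^{(m)}` is distributed as `-log Γ_m`
          HasLaw (W k) ((gammaMeasure ((k : ℝ) + 1) 1).map (fun x => -Real.log x)) P' ∧
          -- the moment generating function of `W^{(m)}`
          (∀ s : ℂ, s.re < (k : ℝ) + 1 →
            Integrable (fun ω => Complex.exp (s * (W k ω : ℝ))) P' ∧
            ∫ ω, Complex.exp (s * (W k ω : ℝ)) ∂P' =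
              Complex.Gamma ((k : ℂ) + 1 - s) / Complex.Gamma ((k : ℂ) + 1)) ∧
          -- the mean of `W^{(m)}`
          Integrable (W k) P' ∧
          Tendsto (fun n : ℕ => ∫ ω, (kthLargest n k (fun i => T i ω) - Real.log n) ∂P)
            atTop (𝓝 (∫ ω, W k ω ∂P')) ∧
          Tendsto (fun n : ℕ => (harmonic n : ℝ) - (harmonic k : ℝ) - Real.log n)
            atTop (𝓝 (∫ ω, W k ω ∂P')) ∧
          ∫ ω, W k ω ∂P' = Real.eulerMascheroniConstant - (harmonic k : ℝ)) ∧
        -- the series represent the centred limits, jointly for all `m`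
        IdentDistrib (fun ω => fun k : ℕ => S k ω)
          (fun ω' => fun k : ℕ => W k ω' - ∫ ω, W k ω ∂P') P P' ∧
        IdentDistrib (fun ω => fun k : ℕ => S k ω)
          (fun ω' => fun k : ℕ =>
            W k ω' - Real.eulerMascheroniConstant + (harmonic k : ℝ)) P P' ∧
        -- `W^{(1)}` has the Gumbel distribution
        (∀ x : ℝ, (P'.map (W 0)) (Set.Iic x) = ENNReal.ofReal (Real.exp (-Real.exp (-x)))) ∧
        -- `W^{(1)}, W^{(2)}, …` is a homogeneous Markov chain; the transition law from `y` is
        -- the Gumbel distribution conditioned on being at most `y`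
        (∃ κ : Kernel ℝ ℝ, IsHomogeneousMarkovChain W κ P' ∧
          (∀ k : ℕ, HasCondDistrib (W (k + 1)) (W k) κ P') ∧
          (∀ y : ℝ, κ y = ProbabilityTheory.cond (P'.map (W 0)) (Set.Iic y)) ∧
          (∀ x y : ℝ, x ≤ y →
            κ y (Set.Iic x) = ENNReal.ofReal (Real.exp (Real.exp (-y) - Real.exp (-x))))) ∧
        -- `(e^{-W^{(1)}}, e^{-W^{(2)}}, …)` is distributed as `(T_1, T_1 + T_2, …)`
        IdentDistrib (fun ω' => fun k : ℕ => Real.exp (-(W k ω')))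
          (fun ω => fun k : ℕ => ∑ i ∈ Finset.range (k + 1), T i ω) P' P := by
  have hT : HasLaw (fun ω i => T i ω) expSeq P :=
    hindep.hasLaw_infinitePi hlaw (aemeasurable_pi_lambda _ fun i => (hlaw i).aemeasurable)
  have hlim := tendstoInDistribution_kthLargest_sub_log hT
  refine ⟨fun n k hk => ⟨fun s hs => ⟨integrable_cexp_mul_kthLargest hT hk.le hs,
    integral_cexp_mul_kthLargest hT hk.le hs⟩, integrable_kthLargest hT n k,
    integral_kthLargest hT hk.le⟩, ⟨gumbelSeq, inferInstance, hlim⟩,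
    fun k ω => centredSeries (fun i => T i ω) k, fun k => ⟨memLp_centredSeries_comp hT k,
      tendsto_eLpNorm_sum_sub_centredSeries_comp hT k, ae_tendsto_sum_centredSeries_comp hT k⟩,
    fun {Ω'} _ P' _ W hW => ?_⟩
  have hWlaw : HasLaw (fun ω k => W k ω) gumbelSeq P' :=
    ⟨hW.aemeasurable_limit, (tendstoInDistribution_unique _ hW hlim).trans Measure.map_id⟩
  have hmean := integral_eval_gumbelSeq hWlaw
  have hgumbel := (hasLaw_eval_zero_gumbelSeq hWlaw).map_eq
  have hchain := isHomogeneousMarkovChain_gumbelSeq hWlaw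
  have hseries := identDistrib_centredSeries_gumbelSeq hT hWlaw
  exact ⟨fun k => ⟨hW.continuous_comp (continuous_apply k), hasLaw_eval_gumbelSeq hWlaw k,
      fun s hs => ⟨integrable_cexp_mul_eval_gumbelSeq hWlaw hs,
        integral_cexp_mul_eval_gumbelSeq hWlaw hs⟩, integrable_eval_gumbelSeq hWlaw k,
      hmean k ▸ tendsto_integral_kthLargest_sub_log hT k,
      hmean k ▸ tendsto_harmonic_sub_harmonic_sub_log k, hmean k⟩,
    by simpa only [hmean, sub_add] using hseries, hseries, fun x => hgumbel ▸ gumbelMeasure_Iic x,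
    ⟨logShiftKernel, hchain, hchain.hasCondDistrib,
      fun y => hgumbel ▸ logShiftKernel_eq_cond_gumbelMeasure y, fun x y => logShiftKernel_Iic⟩,
    identDistrib_exp_neg_gumbelSeq hT hWlaw⟩
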